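/- Let $V_{\mathbb R}$ be a Euclidean space of dimension $\ell\ge 1$, and let $W$ be a finite group generated by orthogonal reflections of $V_{\mathbb R}$ and acting irreducibly on it. Let $V=\mathbb C\otimes V_{\mathbb R}$, with symmetric algebras $S(V)$ and $S(V^*)$, graded by $S^n(V)$ and $S^n(V^*)$. By Chevalley's theorem the algebra $S(V^*)^W$ of invariants is generated by $\ell$ algebraically independent homogeneous elements; let $d_1\le\dots\le d_\ell=:h$ be their degrees. Let $\mathcal S\subset W$ be the set of reflections and, for $s\in\mathcal S$, let $\alpha_s\in V_{\mathbb R}\subset V$ be a root of $s$. Let $c:\mathcal S\to\mathbb C$ be a function invariant under conjugation by $W$. For $y\in V^*$ the Dunkl operator on $S(V)$ is $$\nabla_y(q)=\frac{\partial q}{\partial y}-\sum_{s\in\mathcal S}c(s)\,\langle y,\alpha_s\rangle\,\frac{q-s(q)}{\alpha_s}.$$ The operators $\nabla_y$ commute; for $p\in S(V^*)$ let $\nabla_p$ be the operator on $S(V)$ obtained by substituting the operators $\nabla_y$ for $y$ in $p$. The function $c$ is called regular if no $x\in S(V)$ of positive degree satisfies $\nabla_y(x)=0$ for all $y\in V^*$.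 Let $$\mathcal H^{(c)}=\{x\in S(V):\nabla_p(x)=0 \text{ for all } p\in S(V^*)^W \text{ without constant term}\},$$ $$\mathcal{QH}^{(c,d)}=\{x\in S(V):\nabla_p(x)=0 \text{ for all } p\in S(V^*)^W \text{ without constant term and with } \deg p<d\},$$ and let $\mathcal{QH}^{(c)}=\mathcal{QH}^{(c,h)}$ be the space of quasiharmonic elements. For a graded subspace $U\subset S(V)$ with components $U_n=U\cap S^n(V)$ put $\mathrm{hilb}(U,t)=\sum_{n\ge0}\dim(U_n)\,t^n$, and if $U$ is $W$-stable and $\tau$ is an irreducible complex $W$-module put $\mathrm{ch}_\tau(U,t)=\sum_{n\ge0}[\tau:U_n]\,t^n$, where $[\tau:U_n]=\dim\mathrm{Hom}_W(\tau,U_n)$ is the multiplicity of $\tau$ in $U_n$. Then for every regular $c$ the following identities of formal power series hold. 1. $$\mathrm{hilb}(\mathcal{QH}^{(c)},t)=\frac{\mathrm{hilb}(\mathcal H^{(c)},t)}{1-t^h}=\frac{\prod_{i=1}^{\ell-1}(1-t^{d_i})}{(1-t)^\ell}.$$ 2. For every irreducible $W$-module $\tau$, $$\mathrm{ch}_\tau(\mathcal{QH}^{(c)},t)=\frac{\mathrm{ch}_\tau(\mathcal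 H^{(c)},t)}{1-t^h},$$ and for the trivial module $\mathbf 1$, $\mathrm{ch}_{\mathbf 1}(\mathcal{QH}^{(c)},t)=1/(1-t^h)$. 3. For every irreducible $W$-module $\tau$ and every $i=1,\dots,\ell$, $$\mathrm{ch}_\tau(\mathcal{QH}^{(c,d_i)},t)=\frac{\mathrm{ch}_\tau(\mathcal H^{(c)},t)}{\prod_{j:\,d_j\ge d_i}(1-t^{d_j})},$$ and for the trivial module $\mathbf 1$, $\mathrm{ch}_{\mathbf 1}(\mathcal{QH}^{(c,d_i)},t)=\prod_{j:\,d_j\ge d_i}(1-t^{d_j})^{-1}$. -/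

import Mathlib

open MvPolynomial

noncomputable section

namespace Dunkl

/-- The real Euclidean space `V_ℝ = ℝ^ℓ`. The complexification `V = ℂ ⊗ V_ℝ` has the orthonormal
basis `x_0, …, x_{ℓ-1}` of coordinate vectors and `V*` has the dual basis `y_0, …, y_{ℓ-1}`. -/
abbrev Euc (ℓ : ℕ) : Type := EuclideanSpace ℝ (Fin ℓ)

/-- The symmetric algebra `S(V) = ℂ[x_0, …, x_{ℓ-1}]`. -/
abbrev SymV (ℓ : ℕ) : Type := MvPolynomial (Fin ℓ) ℂ

/-- The symmetric algebra `S(V*) = ℂ[y_0, …, y_{ℓ-1}]`. -/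
abbrev SymDual (ℓ : ℕ) : Type := MvPolynomial (Fin ℓ) ℂ

variable {ℓ : ℕ}

/-- The `j`-th coordinate vector of `V_ℝ`. -/
abbrev basisVec (j : Fin ℓ) : Euc ℓ := EuclideanSpace.single j 1

/-- The inclusion `V_ℝ ⊂ V ⊂ S(V)`. -/
def lin (v : Euc ℓ) : SymV ℓ := ∑ i, C (v i : ℂ) * X i

/-- The action of an isometry `w` on `S(V)`: the algebra map extending `v ↦ w v` on `V`. -/
def act (w : Euc ℓ ≃ₗᵢ[ℝ] Euc ℓ) : SymV ℓ →ₐ[ℂ] SymV ℓ :=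
  aeval fun j => lin (w (basisVec j))

/-- The action of an isometry `w` on `S(V*)`: the algebra map extending the contragredient action
`(w y)(v) = y (w⁻¹ v)` on `V*`. -/
def actDual (w : Euc ℓ ≃ₗᵢ[ℝ] Euc ℓ) : SymDual ℓ →ₐ[ℂ] SymDual ℓ :=
  aeval fun j => ∑ i, C ((w⁻¹ (basisVec i)) j : ℂ) * X i

theorem lin_add (v u : Euc ℓ) : lin (v + u) = lin v + lin u := by
  simp [lin, add_mul, Finset.sum_add_distrib]

theorem lin_smul (a : ℝ) (v : Euc ℓ) : lin (a • v) = C (a : ℂ) * lin v := by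
  simp [lin, Finset.mul_sum, mul_assoc]

theorem lin_sub (v u : Euc ℓ) : lin (v - u) = lin v - lin u := by
  simp [lin, sub_mul, Finset.sum_sub_distrib]

theorem lin_basisVec (j : Fin ℓ) : lin (basisVec j) = X j := by
  simp [lin, PiLp.single_apply, apply_ite]

theorem lin_ne_zero {v : Euc ℓ} (hv : v ≠ 0) : lin v ≠ 0 := by
  intro h
  apply hv
  ext j
  have := congrArg (coeff (Finsupp.single j 1)) h
  simpa [lin, coeff_sum, coeff_C_mul, coeff_X, Finsupp.single_left_inj] using this

theorem act_lin (w : Euc ℓ ≃ₗᵢ[ℝ] Euc ℓ) (v : Euc ℓ) : act w (lin v) = lin (w v) := by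
  have hv : v = ∑ i, v i • basisVec i := by
    ext j
    simp [Pi.single_apply]
  have hsum : ∀ f : Fin ℓ → Euc ℓ, lin (∑ i, f i) = ∑ i, lin (f i) := by
    intro f
    exact map_sum (AddMonoidHom.mk' lin lin_add) f Finset.univ
  conv_rhs => rw [hv]
  rw [map_sum, hsum]
  simp only [map_smul, lin_smul]
  conv_lhs => rw [lin]
  rw [map_sum]
  refine Finset.sum_congr rfl fun i _ => ?_
  rw [map_mul]
  congr 1
  · exact (act w).commutes _
  · simp [act]

theorem act_one : act (1 : Euc ℓ ≃ₗᵢ[ℝ] Euc ℓ) = AlgHom.id ℂ _ := by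
  apply MvPolynomial.algHom_ext
  intro j
  simp only [act, aeval_X, AlgHom.id_apply]
  exact lin_basisVec j

theorem act_mul (w u : Euc ℓ ≃ₗᵢ[ℝ] Euc ℓ) : act (w * u) = (act w).comp (act u) := by
  apply MvPolynomial.algHom_ext
  intro j
  rw [AlgHom.comp_apply]
  conv_rhs => rw [act.eq_1 u, aeval_X, act_lin]
  simp [act]

/-- The group `W` acting on `V_ℝ`. -/
def defRep (W : Subgroup (Euc ℓ ≃ₗᵢ[ℝ] Euc ℓ)) : Representation ℝ W (Euc ℓ) where
  toFun w := (w : Euc ℓ ≃ₗᵢ[ℝ] Euc ℓ).toLinearEquiv.toLinearMap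
  map_one' := rfl
  map_mul' _ _ := rfl

/-- The group `W` acting on `S(V)`. -/
def symRep (W : Subgroup (Euc ℓ ≃ₗᵢ[ℝ] Euc ℓ)) : Representation ℂ W (SymV ℓ) where
  toFun w := (act (w : Euc ℓ ≃ₗᵢ[ℝ] Euc ℓ)).toLinearMap
  map_one' := by rw [Subgroup.coe_one, act_one]; rfl
  map_mul' w u := by rw [Subgroup.coe_mul, act_mul]; rfl

/-- The set of all reflections (in real hyperplanes) that lie in `W`. -/
def reflections (W : Subgroup (Euc ℓ ≃ₗᵢ[ℝ] Euc ℓ)) : Set (Euc ℓ ≃ₗᵢ[ℝ] Euc ℓ) :=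
  {s | s ∈ W ∧ ∃ α : Euc ℓ, α ≠ 0 ∧ s = (ℝ ∙ α)ᗮ.reflection}

/-- `W` is a finite group generated by reflections, acting irreducibly on `V_ℝ`. -/
structure IsIrreducibleReflectionGroup (W : Subgroup (Euc ℓ ≃ₗᵢ[ℝ] Euc ℓ)) : Prop where
  finite : Finite W
  closure_reflections : Subgroup.closure (reflections W) = W
  irreducible : (defRep W).IsIrreducible

variable {W : Subgroup (Euc ℓ ≃ₗᵢ[ℝ] Euc ℓ)}

/-- A root `α_s` of the reflection `s`; it is determined up to a nonzero real factor, on which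
nothing below depends. -/
def root (s : reflections W) : Euc ℓ := s.2.2.choose

theorem root_ne_zero (s : reflections W) : root s ≠ 0 := s.2.2.choose_spec.1

theorem eq_reflection (s : reflections W) :
    (s : Euc ℓ ≃ₗᵢ[ℝ] Euc ℓ) = (ℝ ∙ root s)ᗮ.reflection := s.2.2.choose_spec.2

theorem root_dvd_sub_act (s : reflections W) (q : SymV ℓ) :
    lin (root s) ∣ q - act (s : Euc ℓ ≃ₗᵢ[ℝ] Euc ℓ) q := by
  induction q using MvPolynomial.induction_on with
  | C a =>
    have h : act (s : Euc ℓ ≃ₗᵢ[ℝ] Euc ℓ) (C a) = C a := (act _).commutes a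
    rw [h, sub_self]
    exact dvd_zero _
  | add p q hp hq =>
    rw [map_add, add_sub_add_comm]
    exact dvd_add hp hq
  | mul_X p j hp =>
    have hX : lin (root s) ∣ X j - act (s : Euc ℓ ≃ₗᵢ[ℝ] Euc ℓ) (X j) := by
      rw [← lin_basisVec, act_lin, ← lin_sub, eq_reflection, Submodule.reflection_orthogonal_apply,
        Submodule.reflection_singleton_apply, neg_sub, sub_sub_cancel, ← Nat.cast_smul_eq_nsmul ℝ,
        smul_smul, lin_smul]
      exact Dvd.intro_left _ rfl
    have h : p * X j - act (s : Euc ℓ ≃ₗᵢ[ℝ] Euc ℓ) (p * X j) =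
        (p - act (s : Euc ℓ ≃ₗᵢ[ℝ] Euc ℓ) p) * X j +
          act (s : Euc ℓ ≃ₗᵢ[ℝ] Euc ℓ) p * (X j - act (s : Euc ℓ ≃ₗᵢ[ℝ] Euc ℓ) (X j)) := by
      rw [map_mul]; ring
    rw [h]
    exact dvd_add (hp.mul_right _) (hX.mul_left _)

/-- The polynomial `(q - s(q)) / α_s`. -/
def divDiffFun (s : reflections W) (q : SymV ℓ) : SymV ℓ := (root_dvd_sub_act s q).choose

theorem root_mul_divDiffFun (s : reflections W) (q : SymV ℓ) :
    lin (root s) * divDiffFun s q = q - act (s : Euc ℓ ≃ₗᵢ[ℝ] Euc ℓ) q :=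
  (root_dvd_sub_act s q).choose_spec.symm

/-- The linear operator `q ↦ (q - s(q)) / α_s` on `S(V)`. -/
def divDiff (s : reflections W) : Module.End ℂ (SymV ℓ) where
  toFun := divDiffFun s
  map_add' p q := by
    apply mul_left_cancel₀ (lin_ne_zero (root_ne_zero s))
    rw [mul_add]
    simp only [root_mul_divDiffFun, map_add]
    ring
  map_smul' a q := by
    apply mul_left_cancel₀ (lin_ne_zero (root_ne_zero s))
    rw [mul_smul_comm]
    simp only [root_mul_divDiffFun, map_smul, RingHom.id_apply, smul_sub]

/-- `c` is invariant under conjugation by elements of `W`. -/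
def IsConjInvariant (c : reflections W → ℂ) : Prop :=
  ∀ s t : reflections W, ∀ w ∈ W, (t : Euc ℓ ≃ₗᵢ[ℝ] Euc ℓ) = w * s * w⁻¹ → c t = c s

/-- The Dunkl operator on `S(V)`
`∇_y q = ∂q/∂y - ∑_s c(s) ⟨y, α_s⟩ (q - s(q)) / α_s`, for a vector `y ∈ V*` given by its
coordinates `⟨y, x_j⟩`. (The sum is over the reflections in `W`, a finite set if `W` is finite.) -/
def dunkl (c : reflections W → ℂ) (y : Fin ℓ → ℂ) : Module.End ℂ (SymV ℓ) :=
  ∑ j, y j • (pderiv j : Derivation ℂ (SymV ℓ) (SymV ℓ)).toLinearMap -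
    ∑ᶠ s : reflections W, (c s * ∑ j, y j * (root s j : ℂ)) • divDiff s

/-- The action `∇_p` of `p ∈ S(V*)` on `S(V)`: the monomial `∏ y_j ^ (m j)` acts as the
composition of the operators `∇_{y_j} ^ (m j)` (in increasing order of `j`). -/
def dunklPoly (c : reflections W → ℂ) (p : SymDual ℓ) : Module.End ℂ (SymV ℓ) :=
  ∑ m ∈ p.support, coeff m p • (List.ofFn fun j => dunkl c (Pi.single j 1) ^ m j).prod

/-- `c` is regular: no element of `S(V)` of positive degree is annihilated by all the Dunkl
operators `∇_y`, `y ∈ V*`. -/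
def IsRegularParameter (c : reflections W → ℂ) : Prop :=
  ¬ ∃ x : SymV ℓ, 0 < x.totalDegree ∧ ∀ y : Fin ℓ → ℂ, dunkl c y x = 0

variable (W) in
/-- The algebra of invariants `S(V*)^W`. -/
def invariants : Subalgebra ℂ (SymDual ℓ) :=
  ⨅ w ∈ W, AlgHom.equalizer (actDual w) (AlgHom.id ℂ (SymDual ℓ))

variable (W) in
/-- `d_0 ≤ … ≤ d_{ℓ-1}` are the degrees of `W`, that is, the degrees of elementary invariants:
algebraically independent homogeneous generators of the algebra `S(V*)^W`. -/
def IsDegrees (d : Fin ℓ → ℕ) : Prop :=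
  Monotone d ∧ ∃ e : Fin ℓ → SymDual ℓ, (∀ i, (e i).IsHomogeneous (d i)) ∧
    AlgebraicIndependent ℂ e ∧ Algebra.adjoin ℂ (Set.range e) = invariants W

/-- The space of `(W, c)`-harmonic elements of `S(V)`. -/
def harmonics (c : reflections W → ℂ) : Submodule ℂ (SymV ℓ) where
  carrier := {x | ∀ p ∈ invariants W, constantCoeff p = 0 → dunklPoly c p x = 0}
  zero_mem' _ _ _ := map_zero _
  add_mem' hx hy p hp h := by rw [map_add, hx p hp h, hy p hp h, add_zero]
  smul_mem' a x hx p hp h := by rw [map_smul, hx p hp h, smul_zero]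

/-- The space of all elements of `S(V)` annihilated by `∇_p` for every `W`-invariant `p` without
constant term whose degree is less than `k`. For `k` equal to the largest degree of `W` it is the
space of `(W, c)`-quasiharmonic elements. -/
def truncHarmonics (c : reflections W → ℂ) (k : ℕ) : Submodule ℂ (SymV ℓ) where
  carrier := {x | ∀ p ∈ invariants W, constantCoeff p = 0 → p.totalDegree < k →
    dunklPoly c p x = 0}
  zero_mem' _ _ _ _ := map_zero _
  add_mem' hx hy p hp h h' := by rw [map_add, hx p hp h h', hy p hp h h', add_zero]
  smul_mem' a x hx p hp h h' := by rw [map_smul, hx p hp h h', smul_zero]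

/-- The homogeneous component `U_n = U ∩ S^n(V)`. -/
def component (U : Submodule ℂ (SymV ℓ)) (n : ℕ) : Submodule ℂ (SymV ℓ) :=
  U ⊓ homogeneousSubmodule (Fin ℓ) ℂ n

/-- The Hilbert series `∑ n, dim(U_n) t^n`. -/
def hilb (U : Submodule ℂ (SymV ℓ)) : PowerSeries ℤ :=
  PowerSeries.mk fun n => (Module.finrank ℂ (component U n) : ℤ)

variable {M : Type*} [AddCommGroup M] [Module ℂ M]

/-- The space `Hom_W(τ, U)` of `W`-equivariant linear maps from `τ` to `S(V)` with image in `U`. -/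
def homInto (τ : Representation ℂ W M) (U : Submodule ℂ (SymV ℓ)) :
    Submodule ℂ (τ.IntertwiningMap (symRep W)) where
  carrier := {f | ∀ m, f m ∈ U}
  zero_mem' _ := U.zero_mem
  add_mem' hf hg m := U.add_mem (hf m) (hg m)
  smul_mem' a _ hf m := U.smul_mem a (hf m)

/-- The graded character `∑ n, [τ : U_n] t^n` of a graded `W`-submodule `U` of `S(V)` at an
irreducible `W`-module `τ`, where `[τ : U_n] = dim Hom_W(τ, U_n)` is the multiplicity of `τ` in the
`n`-th homogeneous component of `U`. -/
def gradedChar (τ : Representation ℂ W M) (U : Submodule ℂ (SymV ℓ)) : PowerSeries ℤ :=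
  PowerSeries.mk fun n => (Module.finrank ℂ (homInto τ (component U n)) : ℤ)

end Dunkl

end

/-! ### Action on polynomials, averaging and divided differences -/

noncomputable section

namespace Dunkl

variable {ℓ : ℕ} {W : Subgroup (Euc ℓ ≃ₗᵢ[ℝ] Euc ℓ)}

/-! The Dunkl operators commute, so `p ↦ ∇_p` is an algebra map. Pair `S(V*)` with `S(V)` by `(p, x)
↦ (∇_p x)(0)`. Regularity of `c` says exactly that this pairing is perfect in each degree
(`eq_zero_of_contra_eq_zero`, `exists_contra_eq`), and `∇_e` is the transpose of multiplication by
`e`.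

Let `e_1, …, e_ℓ` be elementary invariants and let `K_J` be the common kernel of the `∇_{e_i}`, `i ∈
J`. It is dual to `S(V*)` modulo the ideal of these `e_i`. Since the `e_i` form a regular sequence
in any order, `e_j` with `j ∉ J` is a nonzerodivisor modulo that ideal; dually, `∇_{e_j}` maps `K_J`
onto itself with kernel `K_{J ∪ {j}}`, lowering degrees by `d_j` (`IsElementary.exists_nabla_eq`).
Hence each added condition multiplies the Hilbert series by `1 - t^{d_j}`. The maps are
`W`-equivariant, so by averaging the same holds for graded multiplicities (`mk_component_mul_prod`).
The spaces of the theorem are `K_J` with `J = {d_i < k}` and `J` everything, and `K_∅ = S(V)` has a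
known series. Harmonics contain the trivial module in degree 0 only.

Regularity of the sequence comes from flatness of the polynomial ring over the invariants
(`mem_span_invariantSyzygies`), proved by induction with divided differences. Flatness also yields
Chevalley's theorem, hence the existence of the degrees.

To obtain the single factor `1 - t^h`, the degree `h` must occur once
(`IsElementary.eq_of_deg_eq_max`). Suppose `e_a` and `e_b` both have degree `h`. On the common zeros
of the invariants of smaller degree, the vector `e_b grad e_a - e_a grad e_b` is orthogonal to the
gradients of all invariants: `⟨grad e_a, grad e_j⟩` is an invariant of degree `h + d_j - 2`, which
lies strictly between `h` and `2h` unless `d_j = 2`, and that case is Euler's identity. So the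
vector vanishes. But `e_a` and `e_b` remain algebraically independent on a component of this zero
set, and a derivation with `D e_a = 1`, `D e_b = 0` gives `e_b = 0` there, a contradiction. -/

theorem act_C (w : Euc ℓ ≃ₗᵢ[ℝ] Euc ℓ) (a : ℂ) : act w (C a) = C a := (act w).commutes a

theorem act_X (w : Euc ℓ ≃ₗᵢ[ℝ] Euc ℓ) (j : Fin ℓ) : act w (X j) = lin (w (basisVec j)) := by
  simp [act]

theorem act_inv_act (w : Euc ℓ ≃ₗᵢ[ℝ] Euc ℓ) (p : SymV ℓ) : act w⁻¹ (act w p) = p := by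
  rw [← AlgHom.comp_apply, ← act_mul, inv_mul_cancel, act_one, AlgHom.id_apply]

theorem isHomogeneous_lin (v : Euc ℓ) : (lin v).IsHomogeneous 1 :=
  IsHomogeneous.sum _ _ _ fun i _ => by
    simpa using (isHomogeneous_C (Fin ℓ) (v i : ℂ)).mul (isHomogeneous_X ℂ i)

theorem isHomogeneous_act (w : Euc ℓ ≃ₗᵢ[ℝ] Euc ℓ) {p : SymV ℓ} {n : ℕ} (hp : p.IsHomogeneous n) :
    (act w p).IsHomogeneous n := by
  have := hp.aeval (fun j => lin (w (basisVec j))) fun j => isHomogeneous_lin (w (basisVec j))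
  rwa [one_mul] at this

theorem totalDegree_act_le (w : Euc ℓ ≃ₗᵢ[ℝ] Euc ℓ) (p : SymV ℓ) :
    (act w p).totalDegree ≤ p.totalDegree := by
  conv_lhs => rw [← sum_homogeneousComponent p, map_sum]
  refine (totalDegree_finsetSum _ _).trans (Finset.sup_le fun i hi => ?_)
  refine (isHomogeneous_act w (homogeneousComponent_isHomogeneous i p)).totalDegree_le.trans ?_
  have := Finset.mem_range.mp hi
  omega

theorem inner_basisVec (v : Euc ℓ) (j : Fin ℓ) : inner ℝ v (basisVec j) = v j := by
  rw [basisVec, EuclideanSpace.inner_single_right]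
  simp

theorem apply_basisVec_symm (w : Euc ℓ ≃ₗᵢ[ℝ] Euc ℓ) (i j : Fin ℓ) :
    (w⁻¹ (basisVec i)) j = (w (basisVec j)) i := by
  rw [← inner_basisVec, ← inner_basisVec (w (basisVec j)), real_inner_comm,
    ← w.inner_map_map (basisVec j)]
  congr 1
  exact w.apply_symm_apply _

/-- The matrix of `w` in an orthonormal basis is orthogonal, hence equal to its inverse transpose.
This allows invariants in `S(V*)` to be treated with the action on `S(V)`. -/
theorem actDual_eq_act (w : Euc ℓ ≃ₗᵢ[ℝ] Euc ℓ) : actDual w = act w := by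
  apply MvPolynomial.algHom_ext
  intro j
  rw [act_X, actDual, aeval_X, lin]
  simp only [apply_basisVec_symm]

theorem mem_invariants {p : SymV ℓ} : p ∈ invariants W ↔ ∀ w ∈ W, act w p = p := by
  simp [invariants, Algebra.mem_iInf, AlgHom.mem_equalizer, actDual_eq_act]

theorem act_eq_of_mem {a : SymV ℓ} (ha : a ∈ invariants W) {w : Euc ℓ ≃ₗᵢ[ℝ] Euc ℓ}
    (hw : w ∈ W) : act w a = a := by
  rw [mem_invariants] at ha
  exact ha w hw

theorem act_of_mem {a : SymV ℓ} (ha : a ∈ invariants W) (w : W) :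
    act (w : Euc ℓ ≃ₗᵢ[ℝ] Euc ℓ) a = a := mem_invariants.mp ha w w.2

variable (W) in
/-- The averaging operator `p ↦ |W|⁻¹ ∑ w, w p`. -/
def avg [Fintype W] : SymV ℓ →ₗ[ℂ] SymV ℓ :=
  (Fintype.card W : ℂ)⁻¹ • ∑ w : W, (act (w : Euc ℓ ≃ₗᵢ[ℝ] Euc ℓ)).toLinearMap

section Avg

variable [Fintype W]

theorem avg_apply (p : SymV ℓ) :
    avg W p = (Fintype.card W : ℂ)⁻¹ • ∑ w : W, act (w : Euc ℓ ≃ₗᵢ[ℝ] Euc ℓ) p := by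
  simp [avg]

theorem avg_mem_invariants (p : SymV ℓ) : avg W p ∈ invariants W := by
  rw [mem_invariants]
  intro u hu
  have h : ∑ w : W, act u (act (w : Euc ℓ ≃ₗᵢ[ℝ] Euc ℓ) p) =
      ∑ w : W, act (w : Euc ℓ ≃ₗᵢ[ℝ] Euc ℓ) p := by
    refine Fintype.sum_equiv (Equiv.mulLeft (⟨u, hu⟩ : W)) _ _ fun w => ?_
    rw [Equiv.coe_mulLeft, Subgroup.coe_mul, act_mul, AlgHom.comp_apply]
  rw [avg_apply, map_smul, map_sum, h]

theorem avg_mul_of_mem {a : SymV ℓ} (ha : a ∈ invariants W) (p : SymV ℓ) :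
    avg W (p * a) = avg W p * a := by
  rw [avg_apply, avg_apply, smul_mul_assoc, Finset.sum_mul]
  congr 1
  refine Finset.sum_congr rfl fun w _ => ?_
  rw [map_mul, act_of_mem ha]

theorem avg_one : avg W (1 : SymV ℓ) = 1 := by
  simp only [avg_apply, map_one, Finset.sum_const, Finset.card_univ]
  rw [← Nat.cast_smul_eq_nsmul ℂ, smul_smul, inv_mul_cancel₀ (by simp), one_smul]

theorem avg_of_mem {a : SymV ℓ} (ha : a ∈ invariants W) : avg W a = a := by
  have := avg_mul_of_mem ha 1
  rwa [one_mul, avg_one, one_mul] at this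

theorem isHomogeneous_avg {p : SymV ℓ} {n : ℕ} (hp : p.IsHomogeneous n) :
    (avg W p).IsHomogeneous n := by
  rw [avg_apply, smul_eq_C_mul]
  simpa using (isHomogeneous_C (Fin ℓ) _).mul
    (IsHomogeneous.sum Finset.univ _ n fun w _ => isHomogeneous_act w.1 hp)

end Avg

theorem divDiff_spec (s : reflections W) (q : SymV ℓ) :
    lin (root s) * divDiff s q = q - act (s : Euc ℓ ≃ₗᵢ[ℝ] Euc ℓ) q := root_mul_divDiffFun s q

theorem divDiff_eq_of_mul_eq {s : reflections W} {q r : SymV ℓ}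
    (h : lin (root s) * r = q - act (s : Euc ℓ ≃ₗᵢ[ℝ] Euc ℓ) q) : divDiff s q = r :=
  mul_left_cancel₀ (lin_ne_zero (root_ne_zero s)) ((divDiff_spec s q).trans h.symm)

/-- Linearity over the invariants: a divided difference turns a relation with invariant `f i` into
another relation of smaller degree. -/
theorem divDiff_mul_of_mem (s : reflections W) {a : SymV ℓ} (ha : a ∈ invariants W) (q : SymV ℓ) :
    divDiff s (q * a) = divDiff s q * a := by
  apply divDiff_eq_of_mul_eq
  rw [map_mul, mem_invariants.mp ha _ s.2.1, ← sub_mul, ← divDiff_spec, mul_assoc]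

/-- The coefficient `(x_j, α_s^∨)` in `s x_j = x_j - (x_j, α_s^∨) α_s`. -/
def corootCoeff (s : reflections W) (v : Euc ℓ) : ℝ := 2 * inner ℝ (root s) v / ‖root s‖ ^ 2

theorem reflection_apply (s : reflections W) (v : Euc ℓ) :
    (s : Euc ℓ ≃ₗᵢ[ℝ] Euc ℓ) v = v - corootCoeff s v • root s := by
  rw [eq_reflection, Submodule.reflection_orthogonal_apply,
    Submodule.reflection_singleton_apply, ← Nat.cast_smul_eq_nsmul ℝ, smul_smul, corootCoeff]
  simp [mul_div_assoc]

theorem divDiff_lin (s : reflections W) (v : Euc ℓ) :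
    divDiff s (lin v) = C (corootCoeff s v : ℂ) := by
  apply divDiff_eq_of_mul_eq
  rw [act_lin, ← lin_sub, reflection_apply, sub_sub_cancel, lin_smul, mul_comm]

theorem divDiff_mul (s : reflections W) (p q : SymV ℓ) :
    divDiff s (p * q) = p * divDiff s q + divDiff s p * act (s : Euc ℓ ≃ₗᵢ[ℝ] Euc ℓ) q := by
  apply divDiff_eq_of_mul_eq
  rw [mul_add, mul_left_comm, divDiff_spec, ← mul_assoc, divDiff_spec, map_mul]
  ring

theorem divDiff_C (s : reflections W) (a : ℂ) : divDiff s (C a) = 0 := by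
  apply divDiff_eq_of_mul_eq
  rw [act_C, sub_self, mul_zero]

theorem totalDegree_divDiff_lt (s : reflections W) {q : SymV ℓ} (hq : divDiff s q ≠ 0) :
    (divDiff s q).totalDegree < q.totalDegree := by
  have h := congrArg totalDegree (divDiff_spec s q)
  rw [totalDegree_mul_of_isDomain (lin_ne_zero (root_ne_zero s)) hq,
    (isHomogeneous_lin _).totalDegree (lin_ne_zero (root_ne_zero s))] at h
  have h1 := totalDegree_sub q (act (s : Euc ℓ ≃ₗᵢ[ℝ] Euc ℓ) q)
  have h2 := totalDegree_act_le (s : Euc ℓ ≃ₗᵢ[ℝ] Euc ℓ) q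
  rw [max_eq_left h2] at h1
  omega

theorem exists_eq_add_single_of_degree_eq_succ {σ : Type*} {n : ℕ} {m : σ →₀ ℕ}
    (hm : m.degree = n + 1) : ∃ (m' : σ →₀ ℕ) (j : σ), m = m' + Finsupp.single j 1 ∧
      m'.degree = n := by
  obtain ⟨j, hj⟩ : ∃ j, m j ≠ 0 := by
    by_contra! h
    have : m = 0 := Finsupp.ext h
    simp [this] at hm
  have h := tsub_add_cancel_of_le (Finsupp.single_le_iff.mpr (Nat.one_le_iff_ne_zero.mpr hj))
  refine ⟨m - Finsupp.single j 1, j, h.symm, ?_⟩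
  rw [← h] at hm
  simpa using hm

theorem isHomogeneous_divDiff_monomial (s : reflections W) (n : ℕ) (m : Fin ℓ →₀ ℕ)
    (hm : m.degree = n + 1) (a : ℂ) : (divDiff s (monomial m a)).IsHomogeneous n := by
  induction n generalizing m with
  | zero =>
    obtain ⟨m, j, rfl, hd⟩ := exists_eq_add_single_of_degree_eq_succ hm
    have hX : monomial (m + Finsupp.single j 1) a = C a * lin (basisVec j) := by
      rw [(Finsupp.degree_eq_zero_iff m).mp hd, lin_basisVec, X, C_mul_monomial, mul_one, zero_add]
    rw [hX, divDiff_mul, divDiff_lin, act_lin, divDiff_C, zero_mul, add_zero, ← C_mul]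
    exact isHomogeneous_C _ _
  | succ n ih =>
    obtain ⟨m, j, rfl, hd⟩ := exists_eq_add_single_of_degree_eq_succ hm
    have hX : monomial (m + Finsupp.single j 1) a = monomial m a * lin (basisVec j) := by
      rw [lin_basisVec, X, monomial_mul, mul_one]
    rw [hX, divDiff_mul, divDiff_lin, act_lin]
    exact ((isHomogeneous_monomial a hd).mul (isHomogeneous_C _ _)).add
      ((ih m hd).mul (isHomogeneous_lin _))

theorem isHomogeneous_divDiff (s : reflections W) {n : ℕ} {p : SymV ℓ}
    (hp : p.IsHomogeneous (n + 1)) : (divDiff s p).IsHomogeneous n := by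
  rw [p.as_sum, map_sum]
  refine IsHomogeneous.sum _ _ _ fun m hm => isHomogeneous_divDiff_monomial s n m ?_ _
  have := hp (mem_support_iff.mp hm)
  rwa [Finsupp.degree_eq_weight_one]

end Dunkl

end

/-! ### Flatness over the invariants -/

noncomputable section

namespace Dunkl

variable {ℓ : ℕ} {W : Subgroup (Euc ℓ ≃ₗᵢ[ℝ] Euc ℓ)} {ι : Type*}

/-- The relations with invariant coefficients between the polynomials `f i`. -/
def invariantSyzygies (W : Subgroup (Euc ℓ ≃ₗᵢ[ℝ] Euc ℓ)) [Fintype ι] (f : ι → SymV ℓ) :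
    Set (ι → SymV ℓ) :=
  {k | (∀ i, k i ∈ invariants W) ∧ ∑ i, k i * f i = 0}

theorem mem_invariantSyzygies [Fintype ι] {f k : ι → SymV ℓ} :
    k ∈ invariantSyzygies W f ↔ (∀ i, k i ∈ invariants W) ∧ ∑ i, k i * f i = 0 := Iff.rfl

theorem act_comp_mem_span_invariantSyzygies [Fintype ι] {f g : ι → SymV ℓ}
    (hg : g ∈ Submodule.span (SymV ℓ) (invariantSyzygies W f)) {w : Euc ℓ ≃ₗᵢ[ℝ] Euc ℓ}
    (hw : w ∈ W) : (fun i => act w (g i)) ∈ Submodule.span (SymV ℓ) (invariantSyzygies W f) := by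
  induction hg using Submodule.span_induction with
  | mem k hk =>
    have h := (mem_invariantSyzygies.mp hk).1
    have : (fun i => act w (k i)) = k := by
      funext i
      exact act_eq_of_mem (h i) hw
    rw [this]
    exact Submodule.subset_span hk
  | zero =>
    simp only [Pi.zero_apply, map_zero]
    exact zero_mem _
  | add a b _ _ ha hb =>
    simp only [Pi.add_apply, map_add]
    exact add_mem ha hb
  | smul r a _ ha =>
    simp only [Pi.smul_apply, smul_eq_mul, map_mul]
    exact Submodule.smul_mem _ (act w r) ha

/-- Modulo a `W`-stable `K`, being fixed by the reflections means being fixed by the group they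
generate, because `1 - uv = (1 - u) + u(1 - v)`; averaging over `W` then changes nothing. -/
theorem sub_avg_mem [Fintype W] (hgen : Subgroup.closure (reflections W) = W)
    (K : Submodule (SymV ℓ) (ι → SymV ℓ))
    (hK : ∀ w ∈ W, ∀ g ∈ K, (fun i => act w (g i)) ∈ K) {g : ι → SymV ℓ}
    (hg : ∀ s ∈ reflections W, (fun i => g i - act s (g i)) ∈ K) :
    (fun i => g i - avg W (g i)) ∈ K := by
  have key : ∀ w ∈ Subgroup.closure (reflections W), (fun i => g i - act w (g i)) ∈ K := by
    intro w hw
    induction hw using Subgroup.closure_induction with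
    | mem s hs => exact hg s hs
    | one =>
      simp only [act_one, AlgHom.id_apply, sub_self]
      exact zero_mem K
    | mul u v hu _ ihu ihv =>
      have := add_mem ihu (hK u (hgen ▸ hu) _ ihv)
      convert this using 1
      funext i
      simp [act_mul]
    | inv u hu ihu =>
      have := neg_mem (hK u⁻¹ (hgen ▸ inv_mem hu) _ ihu)
      convert this using 1
      funext i
      simp [act_inv_act]
  have h := Submodule.smul_mem K (C (Fintype.card W : ℂ)⁻¹)
    (sum_mem (t := Finset.univ) fun (w : W) _ => key w (hgen.symm ▸ w.2))
  convert h using 1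
  funext i
  simp only [Pi.smul_apply, Finset.sum_apply, Finset.sum_sub_distrib, smul_eq_mul, mul_sub,
    Finset.sum_const, Finset.card_univ, avg_apply, smul_eq_C_mul, nsmul_eq_mul, ← mul_assoc]
  congr 1
  rw [← map_natCast (C (σ := Fin ℓ) (R := ℂ)), ← C_mul, inv_mul_cancel₀ (by simp), C_1, one_mul]

/-- The symmetric algebra is flat over the invariants of a finite reflection group. -/
theorem mem_span_invariantSyzygies [Finite W] [Fintype ι]
    (hgen : Subgroup.closure (reflections W) = W) {f : ι → SymV ℓ}
    (hf : ∀ i, f i ∈ invariants W) {g : ι → SymV ℓ} (hg : ∑ i, g i * f i = 0) :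
    g ∈ Submodule.span (SymV ℓ) (invariantSyzygies W f) := by
  have := Fintype.ofFinite W
  -- Only nonzero entries are bounded, since `totalDegree 0 = 0`; thus the case `N = 0` forces `g =
  -- 0`.
  suffices H : ∀ N : ℕ, ∀ g : ι → SymV ℓ, (∀ i, g i ≠ 0 → (g i).totalDegree < N) →
      ∑ i, g i * f i = 0 → g ∈ Submodule.span (SymV ℓ) (invariantSyzygies W f) by
    refine H (Finset.univ.sup (fun i => (g i).totalDegree) + 1) g (fun i _ => ?_) hg
    exact Nat.lt_succ_of_le (Finset.le_sup (f := fun i => (g i).totalDegree) (Finset.mem_univ i))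
  intro N
  induction N with
  | zero =>
    intro g hN _
    have : g = 0 := funext fun i => by
      by_contra h
      exact absurd (hN i h) (Nat.not_lt_zero _)
    rw [this]
    exact zero_mem _
  | succ N ih =>
    intro g hN hg
    -- The divided differences of `g` form a syzygy of smaller degree, so `g - s g = α_s · divDiff s
    -- g` lies in the span by induction. Hence `g` agrees modulo the span with its average, and the
    -- averaged relation is itself an invariant syzygy.
    have h1 := sub_avg_mem hgen _
      (fun w hw k hk => act_comp_mem_span_invariantSyzygies (f := f) hk hw) (g := g) fun s hs => by
        have h := ih (fun i => divDiff ⟨s, hs⟩ (g i)) (fun i hi => by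
          have h0 : g i ≠ 0 := fun h0 => hi (by rw [h0, map_zero])
          have h1 := totalDegree_divDiff_lt _ hi
          have h2 := hN i h0
          omega) (by
          have := congrArg (divDiff ⟨s, hs⟩) hg
          rw [map_sum, map_zero] at this
          rw [← this]
          exact Finset.sum_congr rfl fun i _ => (divDiff_mul_of_mem _ (hf i) _).symm)
        convert Submodule.smul_mem _ (lin (root ⟨s, hs⟩)) h using 1
        funext i
        exact (divDiff_spec ⟨s, hs⟩ (g i)).symm
    have h2 : (fun i => avg W (g i)) ∈ invariantSyzygies W f := by
      refine ⟨fun i => avg_mem_invariants _, ?_⟩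
      have := congrArg (avg W) hg
      rw [map_sum, map_zero] at this
      rw [← this]
      exact Finset.sum_congr rfl fun i _ => (avg_mul_of_mem (hf i) _).symm
    have := add_mem h1 (Submodule.subset_span h2)
    convert this using 1
    funext i
    simp

/-- Consequence of flatness: if `k i ∈ I` for all invariant syzygies `k`, then `g i ∈ I` for
all syzygies `g`. -/
theorem apply_mem_of_sum_mul_eq_zero [Finite W] [Fintype ι]
    (hgen : Subgroup.closure (reflections W) = W) {f : ι → SymV ℓ}
    (hf : ∀ i, f i ∈ invariants W) {g : ι → SymV ℓ} (hg : ∑ i, g i * f i = 0)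
    (I : Ideal (SymV ℓ)) (i : ι) (hI : ∀ k ∈ invariantSyzygies W f, k i ∈ I) : g i ∈ I := by
  have h := mem_span_invariantSyzygies hgen hf hg
  have hle : Submodule.span (SymV ℓ) (invariantSyzygies W f) ≤
      Submodule.comap (LinearMap.proj i : (ι → SymV ℓ) →ₗ[SymV ℓ] SymV ℓ) I :=
    Submodule.span_le.mpr fun k hk => hI k hk
  exact hle h

end Dunkl

end

/-! ### Elementary invariants as a regular sequence -/

noncomputable section

namespace Dunkl

variable {ℓ : ℕ} {W : Subgroup (Euc ℓ ≃ₗᵢ[ℝ] Euc ℓ)}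

theorem mem_span_X_image_of_mul_X_mem {σ R : Type*} [CommSemiring R] {J : Set σ} {j : σ}
    (hj : j ∉ J) {P : MvPolynomial σ R}
    (hP : P * X j ∈ Ideal.span (X '' J : Set (MvPolynomial σ R))) :
    P ∈ Ideal.span (X '' J : Set (MvPolynomial σ R)) := by
  rw [mem_ideal_span_X_image] at hP ⊢
  intro m hm
  obtain ⟨i, hi, h⟩ := hP (m + Finsupp.single j 1) (by
    rw [mem_support_iff, coeff_mul_X]
    exact mem_support_iff.mp hm)
  refine ⟨i, hi, ?_⟩
  have hij : j ≠ i := fun h => hj (h ▸ hi)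
  simpa [Finsupp.single_eq_of_ne' hij] using h

theorem homogeneousComponent_act (w : Euc ℓ ≃ₗᵢ[ℝ] Euc ℓ) (m : ℕ) (p : SymV ℓ) :
    homogeneousComponent m (act w p) = act w (homogeneousComponent m p) := by
  conv_lhs => rw [← sum_homogeneousComponent p, map_sum, map_sum]
  have h : ∀ i, homogeneousComponent m (act w (homogeneousComponent i p)) =
      if i = m then act w (homogeneousComponent m p) else 0 := by
    intro i
    rw [homogeneousComponent_of_mem (isHomogeneous_act w (homogeneousComponent_isHomogeneous i p))]
    split_ifs with h1 h2 h2
    · rw [h1]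
    · exact absurd h1.symm h2
    · exact absurd h2.symm h1
    · rfl
  simp only [h, Finset.sum_ite_eq', Finset.mem_range]
  split_ifs with hm
  · rfl
  · rw [homogeneousComponent_eq_zero _ _ (by omega), map_zero]

theorem homogeneousComponent_mem_invariants {p : SymV ℓ} (hp : p ∈ invariants W) (m : ℕ) :
    homogeneousComponent m p ∈ invariants W := by
  rw [mem_invariants] at hp ⊢
  intro w hw
  rw [← homogeneousComponent_act, hp w hw]

/-- A system of elementary invariants: algebraically independent homogeneous generators `e i`, of
degrees `d i`, of the algebra of invariants. -/
structure IsElementary (W : Subgroup (Euc ℓ ≃ₗᵢ[ℝ] Euc ℓ)) (d : Fin ℓ → ℕ)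
    (e : Fin ℓ → SymV ℓ) : Prop where
  homogeneous : ∀ i, (e i).IsHomogeneous (d i)
  algebraicIndependent : AlgebraicIndependent ℂ e
  adjoin_eq : Algebra.adjoin ℂ (Set.range e) = invariants W

namespace IsElementary

variable {d : Fin ℓ → ℕ} {e : Fin ℓ → SymV ℓ} (he : IsElementary W d e)

include he

theorem mem_invariants_iff {p : SymV ℓ} :
    p ∈ invariants W ↔ ∃ P : MvPolynomial (Fin ℓ) ℂ, aeval e P = p := by
  rw [← he.adjoin_eq, Algebra.adjoin_range_eq_range_aeval]
  rfl

theorem mem (i : Fin ℓ) : e i ∈ invariants W := by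
  rw [← he.adjoin_eq]
  exact Algebra.subset_adjoin ⟨i, rfl⟩

theorem deg_pos (i : Fin ℓ) : 0 < d i := by
  rw [Nat.pos_iff_ne_zero]
  intro h
  have h1 := he.homogeneous i
  rw [h, ← totalDegree_zero_iff_isHomogeneous, totalDegree_eq_zero_iff_eq_C] at h1
  have h2 := he.algebraicIndependent.transcendental i
  rw [h1] at h2
  exact h2 (isAlgebraic_algebraMap _)

theorem constantCoeff_eq_zero (i : Fin ℓ) : constantCoeff (e i) = 0 := by
  rw [constantCoeff_eq]
  exact (he.homogeneous i).coeff_eq_zero (by simpa using (he.deg_pos i).ne)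

/-- Distinct elementary invariants form a regular sequence. -/
theorem mem_span_image_of_mul_mem [Finite W] (hgen : Subgroup.closure (reflections W) = W)
    {J : Finset (Fin ℓ)} {j : Fin ℓ} (hj : j ∉ J) {g : SymV ℓ}
    (hg : g * e j ∈ Ideal.span (e '' J)) : g ∈ Ideal.span (e '' J) := by
  obtain ⟨a, ha⟩ := (Submodule.mem_span_image_finset_iff_exists_fun _).mp hg
  -- By flatness the relation `g e_j = ∑ a_i e_i` need only be examined for invariant coefficients.
  -- These are polynomials in the `e_i`, and by algebraic independence the question becomes that of
  -- the variables of a polynomial ring.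
  have key := apply_mem_of_sum_mul_eq_zero (ι := Option J) hgen
    (f := fun o => o.elim (e j) fun i => e i)
    (g := fun o => o.elim g fun i => -a i)
  refine key ?_ ?_ (Ideal.span (e '' J)) none ?_
  · rintro (_ | i) <;> exact he.mem _
  · rw [Fintype.sum_option]
    simp only [Option.elim_none, Option.elim_some, neg_mul, Finset.sum_neg_distrib]
    rw [← ha]
    simp
  · intro k hk
    obtain ⟨hk1, hk2⟩ := mem_invariantSyzygies.mp hk
    choose P hP using fun o => he.mem_invariants_iff.mp (hk1 o)
    rw [Fintype.sum_option] at hk2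
    simp only [Option.elim_none, Option.elim_some, ← hP] at hk2
    have h : P none * X j + ∑ i : J, P (some i) * X (i : Fin ℓ) = 0 := by
      apply he.algebraicIndependent
      rw [map_zero, ← hk2]
      simp
    have h2 : P none ∈ Ideal.span (X '' (J : Set (Fin ℓ)) : Set (MvPolynomial (Fin ℓ) ℂ)) := by
      apply mem_span_X_image_of_mul_X_mem (j := j) (by simpa using hj)
      rw [eq_neg_of_add_eq_zero_left h]
      exact neg_mem (sum_mem fun i _ => Ideal.mul_mem_left _ _
        (Ideal.subset_span ⟨i, i.2, rfl⟩))
    have h3 := Ideal.mem_map_of_mem (aeval e) h2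
    rw [Ideal.map_span, ← Set.image_comp, hP] at h3
    convert h3 using 3
    simp

theorem isHomogeneous_aeval_monomial (ν : Fin ℓ →₀ ℕ) :
    (aeval e (monomial ν (1 : ℂ))).IsHomogeneous (Finsupp.weight d ν) := by
  rw [aeval_monomial, map_one, one_mul, Finsupp.prod, Finsupp.weight_apply, Finsupp.sum]
  refine IsHomogeneous.prod _ _ _ fun i _ => ?_
  rw [smul_eq_mul, mul_comm]
  exact (he.homogeneous i).pow (ν i)

/-- Homogeneous invariants are combinations of monomials of the same degree in the elementary
invariants. -/
theorem mem_span_monomials {p : SymV ℓ} (hp : p ∈ invariants W) {m : ℕ} (hm : p.IsHomogeneous m) :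
    p ∈ Submodule.span ℂ ((fun ν => aeval e (monomial ν (1 : ℂ))) ''
      {ν : Fin ℓ →₀ ℕ | Finsupp.weight d ν = m}) := by
  obtain ⟨P, rfl⟩ := he.mem_invariants_iff.mp hp
  rw [← homogeneousComponent_eq_self hm]
  conv in aeval e P => rw [P.as_sum]
  rw [map_sum, map_sum]
  refine sum_mem fun ν _ => ?_
  have h1 : monomial ν (coeff ν P) = coeff ν P • monomial ν 1 := by
    rw [smul_monomial, smul_eq_mul, mul_one]
  rw [h1, map_smul, map_smul]
  refine Submodule.smul_mem _ _ ?_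
  rw [homogeneousComponent_of_mem (he.isHomogeneous_aeval_monomial ν)]
  split_ifs with h
  · exact Submodule.subset_span ⟨ν, h.symm, rfl⟩
  · exact zero_mem _

/-- A monomial in the `e_i` of degree `m` with `0 < m < k` contains a factor `e_i`, and then `d_i ≤
m < k`. So truncating by degree imposes only the conditions from the `e_i` with `d_i < k`. -/
theorem mem_span_image_of_totalDegree_lt {p : SymV ℓ} (hp : p ∈ invariants W)
    (h0 : constantCoeff p = 0) {k : ℕ} (hk : p.totalDegree < k) :
    p ∈ Ideal.span (e '' {i | d i < k}) := by
  rw [← sum_homogeneousComponent p]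
  refine sum_mem fun m hm => ?_
  have hm' := Finset.mem_range.mp hm
  rcases Nat.eq_zero_or_pos m with rfl | hm0
  · rw [homogeneousComponent_zero, ← constantCoeff_eq, h0, C_0]
    exact zero_mem _
  have h := he.mem_span_monomials (homogeneousComponent_mem_invariants hp m)
    (homogeneousComponent_isHomogeneous m p)
  have hle : Submodule.span ℂ ((fun ν => aeval e (monomial ν (1 : ℂ))) ''
      {ν : Fin ℓ →₀ ℕ | Finsupp.weight d ν = m}) ≤
      (Ideal.span (e '' {i | d i < k})).restrictScalars ℂ := by
    rw [Submodule.span_le]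
    rintro _ ⟨ν, hν, rfl⟩
    have hν' : Finsupp.weight d ν = m := hν
    obtain ⟨i, hi⟩ : ∃ i, ν i ≠ 0 := by
      by_contra! h
      have : ν = 0 := Finsupp.ext h
      rw [this, map_zero] at hν'
      omega
    have hid : d i ≤ m := by
      rw [← hν']
      exact Finsupp.le_weight_of_ne_zero' d hi
    have : monomial ν (1 : ℂ) = monomial (ν - Finsupp.single i 1) 1 * X i := by
      rw [X, monomial_mul, mul_one, tsub_add_cancel_of_le
        (Finsupp.single_le_iff.mpr (Nat.one_le_iff_ne_zero.mpr hi))]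
    change aeval e (monomial ν (1 : ℂ)) ∈ Ideal.span (e '' {i | d i < k})
    rw [this, map_mul, aeval_X]
    exact Ideal.mul_mem_left _ _ (Ideal.subset_span ⟨i, by simp; omega, rfl⟩)
  exact hle h

end IsElementary

end Dunkl

end

/-! ### Partial derivations for algebraically independent elements -/

noncomputable section

/-- In characteristic zero, algebraically independent elements of a field extension have
partial derivations. -/
theorem AlgebraicIndependent.exists_derivation {ι : Type*} {k K : Type*} [Field k]
    [CharZero k] [Field K] [Algebra k K] [Algebra.EssFiniteType k K] {x : ι → K}
    (hx : AlgebraicIndependent k x) (i : ι) :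
    ∃ D : Derivation k K K, D (x i) = 1 ∧ ∀ j, j ≠ i → D (x j) = 0 := by
  classical
  let : Algebra (MvPolynomial ι k) K := (aeval x).toAlgebra
  have hmap : ∀ p, algebraMap (MvPolynomial ι k) K p = aeval x p := fun _ => rfl
  have : IsScalarTower k (MvPolynomial ι k) K := .of_algebraMap_eq fun a => by
    rw [hmap, MvPolynomial.algebraMap_eq, aeval_C]
  have : FaithfulSMul (MvPolynomial ι k) K :=
    (faithfulSMul_iff_algebraMap_injective _ _).mpr hx
  let := FractionRing.liftAlgebra (MvPolynomial ι k) K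
  have := FractionRing.isScalarTower_liftAlgebra (MvPolynomial ι k) K
  have : IsScalarTower k (FractionRing (MvPolynomial ι k)) K := .of_algebraMap_eq fun a => by
    rw [IsScalarTower.algebraMap_apply k (MvPolynomial ι k) K,
      IsScalarTower.algebraMap_apply (MvPolynomial ι k) (FractionRing (MvPolynomial ι k)) K,
      ← IsScalarTower.algebraMap_apply k (MvPolynomial ι k)]
  have : CharZero (FractionRing (MvPolynomial ι k)) :=
    charZero_of_injective_algebraMap (algebraMap k _).injective
  have : Algebra.EssFiniteType (FractionRing (MvPolynomial ι k)) K := .of_comp k _ _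
  have h2 : Algebra.FormallySmooth (MvPolynomial ι k) (FractionRing (MvPolynomial ι k)) :=
    .of_isLocalization (nonZeroDivisors (MvPolynomial ι k))
  have h3 : Algebra.FormallySmooth (MvPolynomial ι k) K :=
    .comp _ (FractionRing (MvPolynomial ι k)) K
  -- Deform `x_i` to `x_i + ε` in the dual numbers `K[ε]`. Since `K` is formally smooth over `k[x]`,
  -- the identity of `K` lifts to a map `a ↦ a + ε D(a)` compatible with this deformation, and `D`
  -- is the derivation sought.
  let y : ι → TrivSqZeroExt K K := fun j => TrivSqZeroExt.inl (x j) +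
    if j = i then TrivSqZeroExt.inr 1 else 0
  let : Algebra (MvPolynomial ι k) (TrivSqZeroExt K K) := (aeval y).toAlgebra
  have hmap' : ∀ p, algebraMap (MvPolynomial ι k) (TrivSqZeroExt K K) p = aeval y p :=
    fun _ => rfl
  have hfst : ∀ p : MvPolynomial ι k, (TrivSqZeroExt.fstHom k K K) (aeval y p) = aeval x p := by
    intro p
    rw [← AlgHom.comp_apply]
    congr 1
    apply MvPolynomial.algHom_ext
    intro j
    simp only [AlgHom.comp_apply, aeval_X, y]
    split_ifs <;> simp
  let g : TrivSqZeroExt K K →ₐ[MvPolynomial ι k] K :=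
    { (TrivSqZeroExt.fstHom k K K).toRingHom with commutes' := hfst }
  have hg : Function.Surjective g := fun a => ⟨TrivSqZeroExt.inl a, rfl⟩
  have hg' : IsNilpotent (RingHom.ker (g : TrivSqZeroExt K K →+* K)) :=
    ⟨2, TrivSqZeroExt.kerIdeal_sq K K⟩
  let φ := Algebra.FormallySmooth.liftOfSurjective (AlgHom.id (MvPolynomial ι k) K) g hg hg'
  have hφ : ∀ a, (φ a).fst = a := fun a =>
    Algebra.FormallySmooth.liftOfSurjective_apply (AlgHom.id (MvPolynomial ι k) K) g hg hg' a
  have hφk : ∀ a : k, φ (algebraMap k K a) = TrivSqZeroExt.inl (algebraMap k K a) := by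
    intro a
    rw [IsScalarTower.algebraMap_apply k (MvPolynomial ι k) K, φ.commutes, hmap',
      MvPolynomial.algebraMap_eq, aeval_C, hmap, aeval_C]
    rfl
  have hφx : ∀ j, φ (x j) = y j := by
    intro j
    have := φ.commutes (X j)
    rwa [hmap, hmap', aeval_X, aeval_X] at this
  refine ⟨Derivation.mk' (R := k) (A := K) (M := K)
    { toFun := fun a => (φ a).snd
      map_add' := fun a b => by rw [map_add, TrivSqZeroExt.snd_add]
      map_smul' := fun a b => by
        rw [Algebra.smul_def, map_mul, hφk, TrivSqZeroExt.snd_mul]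
        simp [Algebra.smul_def] } fun a b => ?_, ?_, fun j hj => ?_⟩
  · change (φ (a * b)).snd = a • (φ b).snd + b • (φ a).snd
    rw [map_mul, TrivSqZeroExt.snd_mul, hφ, hφ]
    simp [mul_comm]
  · change (φ (x i)).snd = 1
    rw [hφx]
    simp [y]
  · change (φ (x j)).snd = 0
    rw [hφx]
    simp [y, hj]
end

/-! ### Integrality over the invariants and inner products of gradients -/

noncomputable section

namespace Dunkl

variable {ℓ : ℕ} {W : Subgroup (Euc ℓ ≃ₗᵢ[ℝ] Euc ℓ)}

/-- Used twice: to find primes over primes of the invariant ring, and to see that there are `ℓ`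
elementary invariants. -/
theorem isIntegral_invariants [Finite W] : Algebra.IsIntegral (invariants W) (SymV ℓ) := by
  let : MulSemiringAction W (SymV ℓ) :=
    { smul := fun w p => act (w : Euc ℓ ≃ₗᵢ[ℝ] Euc ℓ) p
      one_smul := fun p => by
        change act (1 : Euc ℓ ≃ₗᵢ[ℝ] Euc ℓ) p = p
        rw [act_one, AlgHom.id_apply]
      mul_smul := fun u w p => by
        change act (u * w : Euc ℓ ≃ₗᵢ[ℝ] Euc ℓ) p = act (u : Euc ℓ ≃ₗᵢ[ℝ] Euc ℓ) (act w p)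
        rw [act_mul, AlgHom.comp_apply]
      smul_zero := fun w => map_zero (act (w : Euc ℓ ≃ₗᵢ[ℝ] Euc ℓ))
      smul_add := fun w => map_add (act (w : Euc ℓ ≃ₗᵢ[ℝ] Euc ℓ))
      smul_one := fun w => map_one (act (w : Euc ℓ ≃ₗᵢ[ℝ] Euc ℓ))
      smul_mul := fun w => map_mul (act (w : Euc ℓ ≃ₗᵢ[ℝ] Euc ℓ)) }
  have : Algebra.IsInvariant (invariants W) (SymV ℓ) W :=
    ⟨fun p hp => ⟨⟨p, mem_invariants.mpr fun w hw => hp ⟨w, hw⟩⟩, rfl⟩⟩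
  exact Algebra.IsInvariant.isIntegral (invariants W) (SymV ℓ) W

theorem pderiv_lin_basisVec (w : Euc ℓ ≃ₗᵢ[ℝ] Euc ℓ) (j k : Fin ℓ) :
    pderiv k (lin (w (basisVec j))) = C ((w (basisVec j) k : ℝ) : ℂ) := by
  simp [lin, pderiv_X, Pi.single_apply]

theorem pderiv_act (w : Euc ℓ ≃ₗᵢ[ℝ] Euc ℓ) (k : Fin ℓ) (p : SymV ℓ) :
    pderiv k (act w p) = ∑ j, C ((w (basisVec j) k : ℝ) : ℂ) * act w (pderiv j p) := by
  induction p using MvPolynomial.induction_on with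
  | C a => simp
  | add p q hp hq =>
    simp only [map_add, hp, hq, mul_add, Finset.sum_add_distrib]
  | mul_X p i hp =>
    simp only [map_mul, Derivation.leibniz, smul_eq_mul, hp, map_add, mul_add,
      Finset.sum_add_distrib, act_X, pderiv_lin_basisVec, pderiv_X, Finset.mul_sum]
    congr 1
    · simp only [Pi.single_apply, apply_ite (act w), map_one, map_zero, mul_ite, mul_one, mul_zero,
        Finset.sum_ite_eq, Finset.mem_univ, if_true]
      ring
    · exact Finset.sum_congr rfl fun j _ => by ring

theorem sum_apply_basisVec_mul (w : Euc ℓ ≃ₗᵢ[ℝ] Euc ℓ) (i j : Fin ℓ) :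
    ∑ k, ((w (basisVec i) k : ℝ) : ℂ) * ((w (basisVec j) k : ℝ) : ℂ) = if i = j then 1 else 0 := by
  have h : inner ℝ (w (basisVec j)) (w (basisVec i)) = (if i = j then 1 else 0 : ℝ) := by
    rw [w.inner_map_map, inner_basisVec]
    simp
  rw [PiLp.inner_apply] at h
  have h2 := congrArg (fun r : ℝ => (r : ℂ)) h
  simp only [RCLike.inner_apply, conj_trivial, Complex.ofReal_sum, Complex.ofReal_mul] at h2
  rw [h2]
  split_ifs <;> simp

/-- The polynomial `∑ k, ∂p/∂x_k ∂q/∂x_k`. -/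
def gradInner (p q : SymV ℓ) : SymV ℓ := ∑ k, pderiv k p * pderiv k q

/-- Gradients transform by orthogonal matrices, whose columns are orthonormal. -/
theorem gradInner_mem_invariants {p q : SymV ℓ} (hp : p ∈ invariants W) (hq : q ∈ invariants W) :
    gradInner p q ∈ invariants W := by
  rw [mem_invariants]
  intro w hw
  conv_rhs => rw [gradInner, ← act_eq_of_mem hp hw, ← act_eq_of_mem hq hw]
  simp only [pderiv_act, Finset.sum_mul_sum]
  rw [Finset.sum_comm]
  simp only [gradInner, map_sum, map_mul]
  refine Finset.sum_congr rfl fun i _ => ?_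
  rw [Finset.sum_comm]
  have h : ∀ j, ∑ k, C ((w (basisVec i) k : ℝ) : ℂ) * act w (pderiv i p) *
      (C ((w (basisVec j) k : ℝ) : ℂ) * act w (pderiv j q)) =
      if i = j then act w (pderiv i p) * act w (pderiv j q) else 0 := by
    intro j
    have : ∀ k, C ((w (basisVec i) k : ℝ) : ℂ) * act w (pderiv i p) *
      (C ((w (basisVec j) k : ℝ) : ℂ) * act w (pderiv j q)) =
        C (((w (basisVec i) k : ℝ) : ℂ) * ((w (basisVec j) k : ℝ) : ℂ)) *
          (act w (pderiv i p) * act w (pderiv j q)) := by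
      intro k
      rw [C_mul]
      ring
    simp only [this]
    rw [← Finset.sum_mul, ← map_sum, sum_apply_basisVec_mul]
    split_ifs <;> simp
  simp only [h]
  simp

theorem isHomogeneous_gradInner {p q : SymV ℓ} {m n : ℕ} (hp : p.IsHomogeneous m)
    (hq : q.IsHomogeneous n) : (gradInner p q).IsHomogeneous (m - 1 + (n - 1)) :=
  IsHomogeneous.sum _ _ _ fun _ _ => hp.pderiv.mul hq.pderiv

end Dunkl

end

/-! ### Invariants of degree one and two -/

noncomputable section

namespace Dunkl

variable {ℓ : ℕ} {W : Subgroup (Euc ℓ ≃ₗᵢ[ℝ] Euc ℓ)}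

theorem pderiv_comm {σ R : Type*} [CommRing R] (i j : σ) (p : MvPolynomial σ R) :
    pderiv i (pderiv j p) = pderiv j (pderiv i p) := by
  classical
  have h : ⁅pderiv (R := R) i, pderiv (R := R) j⁆ = 0 := by
    apply MvPolynomial.derivation_ext
    intro k
    rw [Derivation.commutator_apply]
    simp [pderiv_X, Pi.single_apply, apply_ite]
  have := congrArg (fun D => D p) h
  rwa [Derivation.commutator_apply, Derivation.zero_apply, sub_eq_zero] at this

theorem sum_apply_basisVec_mul_real (w : Euc ℓ ≃ₗᵢ[ℝ] Euc ℓ) (i j : Fin ℓ) :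
    ∑ k, w (basisVec i) k * w (basisVec j) k = if i = j then 1 else 0 := by
  have h := sum_apply_basisVec_mul w i j
  have h2 : ((∑ k, w (basisVec i) k * w (basisVec j) k : ℝ) : ℂ) =
      ((if i = j then 1 else 0 : ℝ) : ℂ) := by
    push_cast
    rw [h]
    split_ifs <;> simp
  exact_mod_cast h2

/-- Schur's lemma for symmetric matrices. -/
theorem isScalar_of_invariant_symmetric (hW : IsIrreducibleReflectionGroup W)
    {R : Matrix (Fin ℓ) (Fin ℓ) ℝ} (hR : R.IsHermitian)
    (hinv : ∀ w ∈ W, ∀ a b, R a b = ∑ i, ∑ j, w (basisVec i) a * w (basisVec j) b * R i j) :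
    ∃ β : ℝ, ∀ a b, R a b = if a = b then β else 0 := by
  have := hW.irreducible
  have hne : Nontrivial (Euc ℓ) := by
    by_contra h
    rw [not_nontrivial_iff_subsingleton] at h
    apply bot_ne_top (α := Subrepresentation (defRep W))
    apply Subrepresentation.toSubmodule_injective
    exact Subsingleton.elim _ _
  set T := Matrix.toEuclideanLin R with hT
  have hTs : T.IsSymmetric := Matrix.isSymmetric_toEuclideanLin_iff.mpr hR
  -- Over `ℝ` Schur's lemma needs a real eigenvalue; a symmetric operator has one, the supremum of
  -- the Rayleigh quotient. Then `T - β` is equivariant and not injective, hence zero.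
  have hev := hTs.hasEigenvalue_iSup_of_finiteDimensional
  set β := ⨆ x : { x : Euc ℓ // x ≠ 0 }, RCLike.re (inner ℝ (T x) x) / ‖(x : Euc ℓ)‖ ^ 2
  obtain ⟨v, hv⟩ := hev.exists_hasEigenvector
  have hTb : ∀ (v : Euc ℓ) a, (T v) a = ∑ b, R a b * v b := fun v a => rfl
  have hTj : ∀ j a, (T (basisVec j)) a = R a j := by
    intro j a
    simp [hTb]
  have hcomm : ∀ w ∈ W, ∀ v, T (w v) = w (T v) := by
    intro w hw
    suffices h : T ∘ₗ w.toLinearEquiv.toLinearMap = w.toLinearEquiv.toLinearMap ∘ₗ T from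
      fun v => LinearMap.congr_fun h v
    apply (EuclideanSpace.basisFun (Fin ℓ) ℝ).toBasis.ext
    intro j
    simp only [OrthonormalBasis.coe_toBasis, EuclideanSpace.basisFun_apply]
    change T (w (basisVec j)) = w (T (basisVec j))
    have hexp : T (basisVec j) = ∑ i, R i j • basisVec i := by
      ext a
      rw [hTj]
      simp [Pi.single_apply]
    rw [hexp, map_sum]
    ext a
    rw [hTb]
    simp only [map_smul, WithLp.ofLp_sum, WithLp.ofLp_smul, Finset.sum_apply, Pi.smul_apply,
      smul_eq_mul]
    have h1 : ∀ b, R a b * (w (basisVec j)) b = ∑ i, ∑ k,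
        w (basisVec i) a * R i k * (w (basisVec k) b * w (basisVec j) b) := by
      intro b
      rw [hinv w hw a b, Finset.sum_mul]
      refine Finset.sum_congr rfl fun i _ => ?_
      rw [Finset.sum_mul]
      exact Finset.sum_congr rfl fun k _ => by ring
    simp only [h1]
    rw [Finset.sum_comm]
    refine Finset.sum_congr rfl fun i _ => ?_
    rw [Finset.sum_comm]
    simp only [← Finset.mul_sum, sum_apply_basisVec_mul_real]
    simp [mul_comm]
  let f : Representation.IntertwiningMap (defRep W) (defRep W) :=
    (T - β • LinearMap.id).intertwiningMap_of_isIntertwiningMap _ _ fun w v => by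
      change T ((w : Euc ℓ ≃ₗᵢ[ℝ] Euc ℓ) v) - β • (w : Euc ℓ ≃ₗᵢ[ℝ] Euc ℓ) v =
        (w : Euc ℓ ≃ₗᵢ[ℝ] Euc ℓ) (T v - β • v)
      rw [hcomm _ w.2, map_sub, map_smul]
  have hf : ∀ v, f v = T v - β • v := fun _ => rfl
  have hf0 : f = 0 := by
    refine (Representation.IsIrreducible.injective_or_eq_zero f).resolve_left fun hinj => ?_
    apply hv.2
    apply hinj
    rw [hf, map_zero, hv.apply_eq_smul]
    exact sub_self _
  refine ⟨β, fun a b => ?_⟩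
  have h := hf (basisVec b)
  rw [hf0] at h
  have h2 := congrArg (fun u : Euc ℓ => u a) h
  change (0 : ℝ) = T (basisVec b) a - β * (basisVec b) a at h2
  rw [hTj] at h2
  rw [eq_comm, sub_eq_zero] at h2
  rw [h2]
  simp

/-- The quadratic invariants of an irreducible reflection group are the multiples of
`∑ k, x_k ^ 2`. -/
theorem exists_pderiv_eq_of_degree_two (hW : IsIrreducibleReflectionGroup W) {p : SymV ℓ}
    (hp : p ∈ invariants W) (h2 : p.IsHomogeneous 2) :
    ∃ β : ℂ, ∀ k, pderiv k p = C β * X k := by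
  set B : Fin ℓ → Fin ℓ → ℂ := fun a b => constantCoeff (pderiv a (pderiv b p)) with hB
  have hBC : ∀ a b, pderiv a (pderiv b p) = C (B a b) := by
    intro a b
    have h : (pderiv a (pderiv b p)).IsHomogeneous 0 := h2.pderiv.pderiv
    rw [← totalDegree_zero_iff_isHomogeneous, totalDegree_eq_zero_iff_eq_C] at h
    rw [hB, constantCoeff_eq]
    exact h
  have hsymm : ∀ a b, B a b = B b a := fun a b => by simp only [hB, pderiv_comm a b]
  have hinv : ∀ w ∈ W, ∀ a b, B a b =
      ∑ i, ∑ j, ((w (basisVec i) a * w (basisVec j) b : ℝ) : ℂ) * B i j := by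
    intro w hw a b
    have h : (C (B a b) : SymV ℓ) = ∑ i, ∑ j,
        C (((w (basisVec i) a * w (basisVec j) b : ℝ) : ℂ) * B i j) := by
      rw [← hBC a b, ← act_eq_of_mem hp hw, pderiv_act, map_sum, Finset.sum_comm]
      refine Finset.sum_congr rfl fun j _ => ?_
      rw [pderiv_C_mul, pderiv_act, Finset.mul_sum]
      refine Finset.sum_congr rfl fun i _ => ?_
      rw [hBC, act_C, ← C_mul, ← C_mul]
      push_cast
      ring_nf
    simp only [← map_sum] at h
    exact C_injective _ _ h
  -- The group acts by real matrices, so the real and imaginary parts of the Hessian are separately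
  -- invariant.
  obtain ⟨β₁, hβ₁⟩ := isScalar_of_invariant_symmetric hW (R := fun a b => (B a b).re)
    (Matrix.ext fun a b => congrArg Complex.re (hsymm b a)) (fun w hw a b => by
      have := congrArg Complex.re (hinv w hw a b)
      simpa only [Complex.re_sum, Complex.re_ofReal_mul] using this)
  obtain ⟨β₂, hβ₂⟩ := isScalar_of_invariant_symmetric hW (R := fun a b => (B a b).im)
    (Matrix.ext fun a b => congrArg Complex.im (hsymm b a)) (fun w hw a b => by
      have := congrArg Complex.im (hinv w hw a b)
      simpa only [Complex.im_sum, Complex.im_ofReal_mul] using this)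
  refine ⟨⟨β₁, β₂⟩, fun k => ?_⟩
  have h1 : (pderiv k p).IsHomogeneous 1 := h2.pderiv
  have h := h1.sum_X_mul_pderiv
  rw [one_smul] at h
  rw [← h]
  have hterm : ∀ i, X i * pderiv i (pderiv k p) = if i = k then C ⟨β₁, β₂⟩ * X k else 0 := by
    intro i
    have hBik : B i k = if i = k then ⟨β₁, β₂⟩ else 0 := by
      apply Complex.ext
      · rw [hβ₁ i k]; split_ifs <;> rfl
      · rw [hβ₂ i k]; split_ifs <;> rfl
    rw [hBC, hBik]
    split_ifs with hik
    · rw [hik, mul_comm]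
    · rw [C_0, mul_zero]
  simp [hterm]

/-- An irreducible reflection group of rank at least two has no linear invariants. -/
theorem eq_zero_of_degree_one (hW : IsIrreducibleReflectionGroup W) (hℓ : 2 ≤ ℓ) {p : SymV ℓ}
    (hp : p ∈ invariants W) (h1 : p.IsHomogeneous 1) : p = 0 := by
  -- The Hessian of `p ^ 2` has rank at most one, yet it is a scalar matrix of size at least two. So
  -- it vanishes.
  obtain ⟨β, hβ⟩ := exists_pderiv_eq_of_degree_two hW (mul_mem hp hp) (h1.mul h1)
  have hC : ∀ k, pderiv k p = C (coeff 0 (pderiv k p)) := by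
    intro k
    have h : (pderiv k p).IsHomogeneous 0 := h1.pderiv
    rwa [← totalDegree_zero_iff_isHomogeneous, totalDegree_eq_zero_iff_eq_C] at h
  set b := fun k => coeff 0 (pderiv k p) with hb
  have hpb : ∀ k, C (2 * b k) * p = C β * X k := by
    intro k
    rw [← hβ, Derivation.leibniz, smul_eq_mul, hC, C_mul]
    simp only [map_ofNat]
    ring
  have hE : p = ∑ k, C (b k) * X k := by
    have h := h1.sum_X_mul_pderiv
    rw [one_smul] at h
    conv_lhs => rw [← h]
    exact Finset.sum_congr rfl fun k _ => by rw [hC, mul_comm]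
  have hcoef : ∀ j k, 2 * b k * b j = if k = j then β else 0 := by
    intro j k
    have h := congrArg (pderiv j) (hpb k)
    rw [pderiv_C_mul, pderiv_C_mul, hC, pderiv_X, ← C_mul] at h
    split_ifs with hjk
    · subst hjk
      rw [Pi.single_eq_same, mul_one] at h
      exact C_injective _ _ h
    · rw [Pi.single_eq_of_ne (by exact fun h => hjk h), mul_zero, ← C_0] at h
      exact C_injective _ _ h
  have hb0 : ∀ k, b k = 0 := by
    have h01 := hcoef ⟨0, by omega⟩ ⟨1, by omega⟩
    have h00 := hcoef ⟨0, by omega⟩ ⟨0, by omega⟩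
    have h11 := hcoef ⟨1, by omega⟩ ⟨1, by omega⟩
    simp only [Fin.mk.injEq, one_ne_zero, if_false, if_true] at h01 h00 h11
    have hβ0 : β = 0 := by
      rcases mul_eq_zero.mp h01 with h | h
      · rw [← h11, h, zero_mul]
      · rw [← h00, h, mul_zero]
    intro k
    have h := hcoef k k
    simp only [if_true, hβ0] at h
    simpa using h
  rw [hE]
  simp [hb0]

end Dunkl
end

/-! ### Gradients of invariants at a point -/

noncomputable section

namespace Dunkl

variable {ℓ : ℕ} {W : Subgroup (Euc ℓ ≃ₗᵢ[ℝ] Euc ℓ)}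

/-- The complex-linear extension of `w⁻¹` to `ℂ^ℓ`. -/
def pull (w : Euc ℓ ≃ₗᵢ[ℝ] Euc ℓ) (x : Fin ℓ → ℂ) : Fin ℓ → ℂ :=
  fun j => ∑ k, ((w (basisVec j) k : ℝ) : ℂ) * x k

theorem eval_act (w : Euc ℓ ≃ₗᵢ[ℝ] Euc ℓ) (x : Fin ℓ → ℂ) (p : SymV ℓ) :
    eval x (act w p) = eval (pull w x) p := by
  induction p using MvPolynomial.induction_on with
  | C a => simp
  | add p q hp hq => rw [map_add, map_add, map_add, hp, hq]
  | mul_X p i hp =>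
    rw [map_mul, map_mul, map_mul, hp, act_X, eval_X, lin, map_sum]
    simp [pull]

theorem exists_eval_eq_one_of_finite {σ : Type*} (x : σ → ℂ) (T : Finset (σ → ℂ)) (hT : x ∉ T) :
    ∃ r : MvPolynomial σ ℂ, eval x r = 1 ∧ ∀ y ∈ T, eval y r = 0 := by
  have h : ∀ y : σ → ℂ, ∃ q : MvPolynomial σ ℂ, y ≠ x → eval x q = 1 ∧ eval y q = 0 := by
    intro y
    by_cases hy : y = x
    · exact ⟨0, fun h => absurd hy h⟩
    obtain ⟨i, hi⟩ := Function.ne_iff.mp hy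
    have hi' : x i - y i ≠ 0 := sub_ne_zero.mpr (Ne.symm hi)
    refine ⟨C (x i - y i)⁻¹ * (X i - C (y i)), fun _ => ⟨?_, ?_⟩⟩
    · simp [inv_mul_cancel₀ hi']
    · simp
  choose q hq using h
  refine ⟨∏ y ∈ T, q y, ?_, fun y hy => ?_⟩
  · rw [map_prod]
    exact Finset.prod_eq_one fun y hy => (hq y fun h => hT (h ▸ hy)).1
  · rw [map_prod]
    exact Finset.prod_eq_zero hy (hq y fun h => hT (h ▸ hy)).2

/-- The gradients of the invariants at `x` detect the vectors fixed by the stabilizer of `x`. -/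
theorem eq_zero_of_forall_gradient_eq_zero [Finite W] (x u : Fin ℓ → ℂ)
    (hu : ∀ w ∈ W, pull w x = x → pull w u = u)
    (h : ∀ p ∈ invariants W, ∑ k, u k * eval x (pderiv k p) = 0) : u = 0 := by
  classical
  have := Fintype.ofFinite W
  obtain ⟨r, hr1, hr0⟩ := exists_eval_eq_one_of_finite x
    ((Finset.univ.image fun w : W => pull (w : Euc ℓ ≃ₗᵢ[ℝ] Euc ℓ) x).erase x)
    (Finset.notMem_erase _ _)
  funext i
  -- As `r` is 1 at `x` and 0 on the rest of its orbit, the gradient of `q` is the `i`-th unit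
  -- vector at `x` and zero at the other orbit points; the square makes the latter work. Pairing `u`
  -- with the gradient of the average of `q` then gives `u i` times the order of the stabilizer,
  -- divided by `|W|`.
  set q : SymV ℓ := r ^ 2 * (X i - C (x i)) with hq
  have hq0 : ∀ (w : W) j, eval (pull (w : Euc ℓ ≃ₗᵢ[ℝ] Euc ℓ) x) (pderiv j q) =
      if pull (w : Euc ℓ ≃ₗᵢ[ℝ] Euc ℓ) x = x ∧ j = i then 1 else 0 := by
    intro w j
    by_cases hw : pull (w : Euc ℓ ≃ₗᵢ[ℝ] Euc ℓ) x = x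
    · simp [hq, hw, Derivation.leibniz, hr1, pderiv_X, Pi.single_apply, apply_ite,
        eq_comm]
    · have hr := hr0 _ (Finset.mem_erase.mpr ⟨hw, Finset.mem_image_of_mem _ (Finset.mem_univ w)⟩)
      simp [hq, hw, Derivation.leibniz, hr]
  have h1 := h _ (avg_mem_invariants q)
  have h2 : ∀ w : W, ∑ k, u k * eval x (pderiv k (act (w : Euc ℓ ≃ₗᵢ[ℝ] Euc ℓ) q)) =
      if pull (w : Euc ℓ ≃ₗᵢ[ℝ] Euc ℓ) x = x then u i else 0 := by
    intro w
    simp only [pderiv_act, map_sum, map_mul, eval_C, eval_act, hq0]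
    by_cases hw : pull (w : Euc ℓ ≃ₗᵢ[ℝ] Euc ℓ) x = x
    · have := congrFun (hu w w.2 hw) i
      simp only [hw, true_and, mul_ite, mul_one, mul_zero, Finset.sum_ite_eq', Finset.mem_univ,
        if_true]
      rw [← this, pull]
      exact Finset.sum_congr rfl fun k _ => mul_comm _ _
    · simp [hw]
  have h3 : ∑ w : W, ∑ k, u k * eval x (pderiv k (act (w : Euc ℓ ≃ₗᵢ[ℝ] Euc ℓ) q)) = 0 := by
    have h4 : ∀ k, u k * eval x (pderiv k (avg W q)) = (Fintype.card W : ℂ)⁻¹ *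
        ∑ w : W, u k * eval x (pderiv k (act (w : Euc ℓ ≃ₗᵢ[ℝ] Euc ℓ) q)) := by
      intro k
      rw [avg_apply, smul_eq_C_mul, pderiv_C_mul, map_mul, eval_C, map_sum, map_sum,
        ← Finset.mul_sum]
      ring
    simp only [h4, ← Finset.mul_sum (a := (Fintype.card W : ℂ)⁻¹)] at h1
    rw [Finset.sum_comm]
    exact (mul_eq_zero.mp h1).resolve_left (inv_ne_zero (by simp))
  simp only [h2] at h3
  rw [← Finset.sum_filter, Finset.sum_const, nsmul_eq_mul] at h3
  refine (mul_eq_zero.mp h3).resolve_left ?_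
  refine Nat.cast_ne_zero.mpr ?_
  refine Finset.card_ne_zero_of_mem (a := 1) (Finset.mem_filter.mpr ⟨Finset.mem_univ _, ?_⟩)
  funext j
  simp [pull, apply_ite]

theorem pull_gradient_eq {p : SymV ℓ} (hp : p ∈ invariants W) {x : Fin ℓ → ℂ}
    {w : Euc ℓ ≃ₗᵢ[ℝ] Euc ℓ} (hw : w ∈ W) (hx : pull w x = x) :
    pull w (fun k => eval x (pderiv k p)) = fun k => eval x (pderiv k p) := by
  funext i
  have h : ∀ k, eval x (pderiv k p) =
      ∑ j, ((w (basisVec j) k : ℝ) : ℂ) * eval x (pderiv j p) := by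
    intro k
    conv_lhs => rw [← act_eq_of_mem hp hw, pderiv_act]
    simp only [map_sum, map_mul, eval_C, eval_act, hx]
  rw [pull]
  conv_lhs => enter [2, k]; rw [h k]
  simp only [Finset.mul_sum]
  rw [Finset.sum_comm]
  simp only [← mul_assoc, ← Finset.sum_mul, sum_apply_basisVec_mul]
  simp

theorem pull_add_smul (w : Euc ℓ ≃ₗᵢ[ℝ] Euc ℓ) (a b : ℂ) (u v : Fin ℓ → ℂ) :
    pull w (fun k => a * u k - b * v k) = fun k => a * pull w u k - b * pull w v k := by
  funext i
  simp only [pull, mul_sub, Finset.sum_sub_distrib, Finset.mul_sum]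
  congr 1 <;> exact Finset.sum_congr rfl fun k _ => by ring

namespace IsElementary

variable {d : Fin ℓ → ℕ} {e : Fin ℓ → SymV ℓ} (he : IsElementary W d e)

include he

/-- A monomial in elementary invariants of degree `h` alone has degree divisible by `h`; any other
monomial has a factor vanishing at `x`. -/
theorem eval_eq_zero_of_not_dvd {p : SymV ℓ} (hp : p ∈ invariants W) {m h : ℕ}
    (hm : p.IsHomogeneous m) (hmax : ∀ i, d i ≤ h) (hdvd : ¬ h ∣ m) {x : Fin ℓ → ℂ}
    (hx : ∀ i, d i < h → eval x (e i) = 0) : eval x p = 0 := by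
  have key := he.mem_span_monomials hp hm
  have hle : Submodule.span ℂ ((fun ν => aeval e (monomial ν (1 : ℂ))) ''
      {ν : Fin ℓ →₀ ℕ | Finsupp.weight d ν = m}) ≤ LinearMap.ker (aeval x).toLinearMap := by
    rw [Submodule.span_le]
    rintro _ ⟨ν, hν, rfl⟩
    have hν' : Finsupp.weight d ν = m := hν
    obtain ⟨i, hi, hid⟩ : ∃ i, ν i ≠ 0 ∧ d i < h := by
      by_contra! hcon
      apply hdvd
      rw [← hν', Finsupp.weight_apply, Finsupp.sum]
      refine Finset.dvd_sum fun i hi => ?_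
      rw [(hmax i).antisymm (hcon i (Finsupp.mem_support_iff.mp hi)), smul_eq_mul]
      exact dvd_mul_left _ _
    change aeval x (aeval e (monomial ν (1 : ℂ))) = 0
    rw [aeval_monomial, map_one, one_mul, Finsupp.prod, map_prod]
    refine Finset.prod_eq_zero (Finsupp.mem_support_iff.mpr hi) ?_
    rw [map_pow, aeval_eq_eval, hx i hid, zero_pow hi]
  have := hle key
  rwa [LinearMap.mem_ker, AlgHom.toLinearMap_apply, aeval_eq_eval] at this

/-- Two elementary invariants of maximal degree have proportional differentials along the common
zeros of the elementary invariants of smaller degree. -/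
theorem eval_mul_pderiv_eq (hW : IsIrreducibleReflectionGroup W) (hℓ : 2 ≤ ℓ) {h : ℕ}
    (hmax : ∀ i, d i ≤ h) {a b : Fin ℓ} (ha : d a = h) (hb : d b = h) {x : Fin ℓ → ℂ}
    (hx : ∀ i, d i < h → eval x (e i) = 0) (k : Fin ℓ) :
    eval x (e b * pderiv k (e a) - e a * pderiv k (e b)) = 0 := by
  have := hW.finite
  have hd2 : ∀ i, 2 ≤ d i := by
    intro i
    by_contra hlt
    have h1 : d i = 1 := by have := he.deg_pos i; omega
    have := eq_zero_of_degree_one hW hℓ (he.mem i) (h1 ▸ he.homogeneous i)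
    exact he.algebraicIndependent.ne_zero i this
  -- The vector `u` is fixed by the stabilizer of `x`, being a combination of gradients of
  -- invariants at `x`. It therefore vanishes once it is orthogonal to all such gradients, and by
  -- Leibniz' rule the generators `e j` suffice.
  set u : Fin ℓ → ℂ := fun k => eval x (e b) * eval x (pderiv k (e a)) -
    eval x (e a) * eval x (pderiv k (e b)) with hu
  suffices H : u = 0 by
    have := congrFun H k
    simpa [hu] using this
  have hgrad : ∀ p, ∑ k, u k * eval x (pderiv k p) =
      eval x (e b) * eval x (gradInner (e a) p) - eval x (e a) * eval x (gradInner (e b) p) := by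
    intro p
    simp only [hu, gradInner, map_sum, map_mul, Finset.mul_sum, ← Finset.sum_sub_distrib]
    exact Finset.sum_congr rfl fun k _ => by ring
  have hEuler : ∀ i, d i = h → ∑ k, eval x (pderiv k (e i)) * x k = h * eval x (e i) := by
    intro i hi
    have h1 := congrArg (eval x) (he.homogeneous i).sum_X_mul_pderiv
    rw [map_nsmul, nsmul_eq_mul, hi, map_sum] at h1
    rw [← h1]
    exact Finset.sum_congr rfl fun k _ => by rw [map_mul, eval_X, mul_comm]
  refine eq_zero_of_forall_gradient_eq_zero (W := W) x u ?_ ?_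
  · intro w hw hwx
    rw [hu, pull_add_smul, pull_gradient_eq (he.mem a) hw hwx, pull_gradient_eq (he.mem b) hw hwx]
  · intro p hp
    rw [← he.adjoin_eq] at hp
    induction hp using Algebra.adjoin_induction with
    | mem p hp =>
      obtain ⟨j, rfl⟩ := hp
      -- If `d j = 2`, the gradient of `e j` is a multiple of `x` and Euler's identity makes the two
      -- terms cancel. If `d j > 2`, then `h < h + d j - 2 < 2h`, so the degree of `gradInner (e i)
      -- (e j)` is not a multiple of `h`.
      rcases (hd2 j).eq_or_lt with hj | hj
      · obtain ⟨β, hβ⟩ := exists_pderiv_eq_of_degree_two hW (he.mem j) (hj ▸ he.homogeneous j)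
        have h1 : ∀ k, u k * eval x (pderiv k (e j)) =
            β * (eval x (e b) * (eval x (pderiv k (e a)) * x k) -
              eval x (e a) * (eval x (pderiv k (e b)) * x k)) := by
          intro k
          rw [hβ, map_mul, eval_C, eval_X, hu]
          ring
        simp only [h1, ← Finset.mul_sum, Finset.sum_sub_distrib]
        rw [hEuler a ha, hEuler b hb]
        ring
      · rw [hgrad]
        have h1 : ∀ i, d i = h → eval x (gradInner (e i) (e j)) = 0 := by
          intro i hi
          refine he.eval_eq_zero_of_not_dvd (gradInner_mem_invariants (he.mem i) (he.mem j))
            (isHomogeneous_gradInner (he.homogeneous i) (he.homogeneous j)) hmax ?_ hx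
          rw [hi]
          have h2 := hmax j
          rintro ⟨c, hc⟩
          have hc1 : 1 < c := by
            by_contra hcon
            have : h * c ≤ h * 1 := Nat.mul_le_mul_left h (by omega)
            omega
          have : h * 2 ≤ h * c := Nat.mul_le_mul_left h hc1
          omega
        rw [h1 a ha, h1 b hb, mul_zero, mul_zero, sub_zero]
    | algebraMap r => simp [MvPolynomial.algebraMap_eq]
    | add p q _ _ hp hq =>
      simp only [map_add, mul_add, Finset.sum_add_distrib, hp, hq, add_zero]
    | mul p q _ _ hp hq =>
      have h1 : ∀ k, u k * eval x (pderiv k (p * q)) =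
          eval x p * (u k * eval x (pderiv k q)) + eval x q * (u k * eval x (pderiv k p)) := by
        intro k
        rw [Derivation.leibniz, smul_eq_mul, smul_eq_mul, map_add, map_mul, map_mul]
        ring
      simp only [h1, Finset.sum_add_distrib, ← Finset.mul_sum, hp, hq, mul_zero, add_zero]

end IsElementary

end Dunkl
end

/-! ### The largest degree occurs once -/

noncomputable section

namespace Dunkl

variable {ℓ : ℕ} {W : Subgroup (Euc ℓ ≃ₗᵢ[ℝ] Euc ℓ)}

/-- The chain rule, used both in a residue field and for relations between invariants. -/
theorem derivation_algebraMap_apply {σ k K : Type*} [Fintype σ] [CommRing k] [CommRing K]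
    [Algebra k K] (π : MvPolynomial σ k →ₐ[k] K) (D : Derivation k K K) (p : MvPolynomial σ k) :
    D (π p) = ∑ i, π (pderiv i p) * D (π (X i)) := by
  classical
  induction p using MvPolynomial.induction_on with
  | C a => simp [← MvPolynomial.algebraMap_eq]
  | add p q hp hq => simp only [map_add, add_mul, Finset.sum_add_distrib, hp, hq]
  | mul_X p j hp =>
    simp only [map_mul, Derivation.leibniz, smul_eq_mul, hp, map_add, add_mul,
      Finset.sum_add_distrib, pderiv_X, Finset.mul_sum]
    congr 1
    · simp [Pi.single_apply, apply_ite]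
    · exact Finset.sum_congr rfl fun i _ => by ring

namespace IsElementary

variable {d : Fin ℓ → ℕ} {e : Fin ℓ → SymV ℓ} (he : IsElementary W d e)

include he

/-- A prime ideal that contains the elementary invariants outside `T` and modulo which the ones in
`T` are algebraically independent. -/
theorem exists_prime [Finite W] (T : Set (Fin ℓ)) :
    ∃ P : Ideal (SymV ℓ), P.IsPrime ∧ (∀ i ∉ T, e i ∈ P) ∧
      ∀ p : MvPolynomial T ℂ, aeval (fun i : T => e i) p ∈ P → p = 0 := by
  classical
  have := isIntegral_invariants (W := W)
  -- Setting the `e i` outside `T` to zero maps the invariants to a polynomial ring, a domain. The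
  -- kernel is prime, and lying-over provides `P` contracting to it.
  let θ : MvPolynomial (Fin ℓ) ℂ →ₐ[ℂ] MvPolynomial T ℂ :=
    aeval fun i => if h : i ∈ T then X ⟨i, h⟩ else 0
  let ψ : invariants W →ₐ[ℂ] MvPolynomial (Fin ℓ) ℂ :=
    he.algebraicIndependent.aevalEquiv.symm.toAlgHom.comp
      (Subalgebra.inclusion he.adjoin_eq.ge)
  have hψ : ∀ Q (hQ : aeval e Q ∈ invariants W), ψ ⟨aeval e Q, hQ⟩ = Q := by
    intro Q hQ
    change he.algebraicIndependent.aevalEquiv.symm _ = Q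
    rw [AlgEquiv.symm_apply_eq]
    apply Subtype.ext
    simp
  have hprime : (RingHom.ker (θ.comp ψ)).IsPrime := RingHom.ker_isPrime (θ.comp ψ)
  obtain ⟨P, -, hP, hcomap⟩ := Ideal.exists_ideal_over_prime_of_isIntegral
    (RingHom.ker (θ.comp ψ)) (⊥ : Ideal (SymV ℓ)) (by
      rw [Ideal.comap_bot_of_injective _ Subtype.val_injective]
      exact bot_le)
  have hmem : ∀ Q, aeval e Q ∈ P ↔ θ Q = 0 := by
    intro Q
    have hQ : aeval e Q ∈ invariants W := he.mem_invariants_iff.mpr ⟨Q, rfl⟩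
    have h1 : (⟨aeval e Q, hQ⟩ : invariants W) ∈ P.comap (algebraMap (invariants W) (SymV ℓ)) ↔
      aeval e Q ∈ P := Iff.rfl
    rw [← h1, hcomap, RingHom.mem_ker, AlgHom.comp_apply, hψ]
  refine ⟨P, hP, fun i hi => ?_, fun p hp => ?_⟩
  · have := (hmem (X i)).mpr (by simp [θ, hi])
    rwa [aeval_X] at this
  · have h1 : aeval (fun i : T => e i) p = aeval e (rename (Subtype.val : T → Fin ℓ) p) := by
      rw [aeval_rename]
      rfl
    rw [h1, hmem] at hp
    have h2 : θ.comp (rename (Subtype.val : T → Fin ℓ)) = AlgHom.id ℂ _ := by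
      apply MvPolynomial.algHom_ext
      intro i
      simp [θ]
    rw [← AlgHom.comp_apply, h2] at hp
    exact hp

/-- The largest degree of an irreducible reflection group occurs only once. -/
theorem eq_of_deg_eq_max (hW : IsIrreducibleReflectionGroup W) {h : ℕ}
    (hmax : ∀ i, d i ≤ h) {a b : Fin ℓ} (ha : d a = h) (hb : d b = h) : a = b := by
  by_contra hab
  have hℓ : 2 ≤ ℓ := by
    by_contra hlt
    have : Subsingleton (Fin ℓ) := Fin.subsingleton_iff_le_one.mpr (by omega)
    exact hab (Subsingleton.elim a b)
  have := hW.finite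
  obtain ⟨P, hP, hP1, hP2⟩ := he.exists_prime {i | d i = h}
  -- By the Nullstellensatz it is enough to check vanishing on the zeros of `P`, where the
  -- invariants of smaller degree vanish.
  have hmem : ∀ k, e b * pderiv k (e a) - e a * pderiv k (e b) ∈ P := by
    intro k
    rw [← hP.isRadical.radical, ← vanishingIdeal_zeroLocus_eq_radical (K := ℂ)]
    intro x hx
    rw [aeval_eq_eval]
    refine he.eval_mul_pderiv_eq hW hℓ hmax ha hb (fun i hi => ?_) k
    rw [← aeval_eq_eval]
    exact hx _ (hP1 i hi.ne)
  let K := FractionRing (SymV ℓ ⧸ P)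
  let π : SymV ℓ →ₐ[ℂ] K :=
    (IsScalarTower.toAlgHom ℂ (SymV ℓ ⧸ P) K).comp (Ideal.Quotient.mkₐ ℂ P)
  have hπ : ∀ p, π p = 0 ↔ p ∈ P := by
    intro p
    rw [← Ideal.Quotient.eq_zero_iff_mem]
    exact (IsFractionRing.injective (SymV ℓ ⧸ P) K).eq_iff' (map_zero _)
  have hind : AlgebraicIndependent ℂ fun i : {i | d i = h} => π (e i) := by
    rw [algebraicIndependent_iff]
    intro p hp
    apply hP2
    rw [← hπ, ← AlgHom.comp_apply, comp_aeval]
    exact hp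
  obtain ⟨D, hD1, hD0⟩ := hind.exists_derivation ⟨a, ha⟩
  have hDb : D (π (e b)) = 0 := hD0 ⟨b, hb⟩ fun h => hab (congrArg Subtype.val h).symm
  -- The chain rule turns proportional differentials modulo `P` into `e_b D e_a = e_a D e_b`, that
  -- is, `e_b = 0` in the residue field.
  have key : π (e b) * D (π (e a)) - π (e a) * D (π (e b)) = 0 := by
    rw [derivation_algebraMap_apply, derivation_algebraMap_apply, Finset.mul_sum, Finset.mul_sum,
      ← Finset.sum_sub_distrib]
    refine Finset.sum_eq_zero fun k _ => ?_
    have := (hπ _).mpr (hmem k)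
    rw [map_sub, map_mul, map_mul] at this
    rw [← mul_assoc, ← mul_assoc, ← sub_mul, this, zero_mul]
  rw [hDb, hD1, mul_one, mul_zero, sub_zero] at key
  exact hind.ne_zero ⟨b, hb⟩ key

end IsElementary

end Dunkl
end

/-! ### Chevalley's theorem -/

noncomputable section

namespace Dunkl

variable {ℓ : ℕ} {W : Subgroup (Euc ℓ ≃ₗᵢ[ℝ] Euc ℓ)}

theorem totalDegree_pderiv_lt {σ R : Type*} [CommSemiring R] {i : σ} {p : MvPolynomial σ R}
    (h : pderiv i p ≠ 0) : (pderiv i p).totalDegree < p.totalDegree := by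
  have key : ∀ m ∈ (pderiv i p).support, (m.sum fun _ e => e) + 1 ≤ p.totalDegree := by
    intro m hm
    rw [mem_support_iff, coeff_pderiv] at hm
    have h1 := le_totalDegree (mem_support_iff.mpr (left_ne_zero_of_mul hm))
    rwa [Finsupp.sum_add_index' (fun _ => rfl) (fun _ _ _ => rfl), Finsupp.sum_single_index rfl]
      at h1
  obtain ⟨m, hm⟩ := (support_nonempty (p := pderiv i p)).mpr h
  have h0 := key m hm
  rw [totalDegree, Finset.sup_lt_iff (by rw [Nat.bot_eq_zero]; omega)]
  intro m hm
  have := key m hm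
  omega

theorem eq_C_of_forall_pderiv_eq_zero {σ R : Type*} [CommRing R] [IsDomain R] [CharZero R]
    {p : MvPolynomial σ R} (h : ∀ i, pderiv i p = 0) : p = C (coeff 0 p) := by
  classical
  ext m
  rw [coeff_C]
  split_ifs with hm
  · rw [hm]
  · obtain ⟨i, hi⟩ : ∃ i, m i ≠ 0 := by
      by_contra! hcon
      exact hm (Finsupp.ext fun i => (hcon i).symm)
    have h1 := congrArg (coeff (m - Finsupp.single i 1)) (h i)
    rw [coeff_pderiv, coeff_zero, tsub_add_cancel_of_le
      (Finsupp.single_le_iff.mpr (Nat.one_le_iff_ne_zero.mpr hi))] at h1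
    refine (mul_eq_zero.mp h1).resolve_right ?_
    exact Nat.cast_add_one_ne_zero _

theorem homogeneousComponent_mul_of_isHomogeneous {σ R : Type*} [CommSemiring R]
    {f : MvPolynomial σ R} {d : ℕ} (hf : f.IsHomogeneous d) (a : MvPolynomial σ R) (m : ℕ) :
    homogeneousComponent m (a * f) =
      if d ≤ m then homogeneousComponent (m - d) a * f else 0 := by
  conv_lhs => rw [← sum_homogeneousComponent a, Finset.sum_mul, map_sum]
  have h : ∀ i, homogeneousComponent m (homogeneousComponent i a * f) =
      if i + d = m then homogeneousComponent i a * f else 0 := by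
    intro i
    rw [homogeneousComponent_of_mem ((homogeneousComponent_isHomogeneous i a).mul hf)]
    simp only [eq_comm]
  simp only [h]
  split_ifs with hd
  · have h2 : ∀ i, i + d = m ↔ i = m - d := fun i => by omega
    simp only [h2, Finset.sum_ite_eq', Finset.mem_range]
    split_ifs with hm
    · rfl
    · rw [homogeneousComponent_eq_zero _ _ (by omega), zero_mul]
  · exact Finset.sum_eq_zero fun i _ => if_neg (by omega)

/-- The homogeneous invariants of positive degree. -/
def homogeneousInvariants (W : Subgroup (Euc ℓ ≃ₗᵢ[ℝ] Euc ℓ)) : Set (SymV ℓ) :=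
  {p | p ∈ invariants W ∧ ∃ m, 0 < m ∧ p.IsHomogeneous m}

theorem mem_span_homogeneousInvariants {p : SymV ℓ} (hp : p ∈ invariants W)
    (h0 : constantCoeff p = 0) : p ∈ Ideal.span (homogeneousInvariants W) := by
  rw [← sum_homogeneousComponent p]
  refine sum_mem fun m _ => ?_
  rcases Nat.eq_zero_or_pos m with rfl | hm
  · rw [homogeneousComponent_zero, ← constantCoeff_eq, h0, C_0]
    exact zero_mem _
  · exact Ideal.subset_span ⟨homogeneousComponent_mem_invariants hp m, m, hm,
      homogeneousComponent_isHomogeneous m p⟩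

section

variable {ι : Type*} [Fintype ι] {f : ι → SymV ℓ} {deg : ι → ℕ}

/-- In degree `deg i`, a nonzero constant term of `r i` would express `f i` through the other
generators. -/
theorem constantCoeff_eq_zero_of_sum_mul_eq_zero (hdeg : ∀ i, (f i).IsHomogeneous (deg i))
    (hmin : ∀ i, f i ∉ Ideal.span (f '' {j | j ≠ i})) {r : ι → SymV ℓ}
    (hr : ∑ i, r i * f i = 0) (i : ι) : constantCoeff (r i) = 0 := by
  classical
  by_contra hne
  apply hmin i
  have h1 := congrArg (homogeneousComponent (deg i)) hr
  rw [map_sum, map_zero, ← Finset.add_sum_erase _ _ (Finset.mem_univ i),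
    homogeneousComponent_mul_of_isHomogeneous (hdeg i), if_pos le_rfl, Nat.sub_self,
    homogeneousComponent_zero, ← constantCoeff_eq] at h1
  have h2 : f i = C (constantCoeff (r i))⁻¹ * (C (constantCoeff (r i)) * f i) := by
    rw [← mul_assoc, ← C_mul, inv_mul_cancel₀ hne, C_1, one_mul]
  rw [h2, eq_neg_of_add_eq_zero_left h1]
  refine Ideal.mul_mem_left _ _ (neg_mem (sum_mem fun j hj => ?_))
  rw [homogeneousComponent_mul_of_isHomogeneous (hdeg j)]
  split_ifs
  · exact Ideal.mul_mem_left _ _ (Ideal.subset_span ⟨j, (Finset.mem_erase.mp hj).1, rfl⟩)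
  · exact zero_mem _

/-- Homogeneous generators of the ideal generated by the invariants of positive degree generate the
algebra of invariants. -/
theorem adjoin_eq_invariants [Finite W] (hf : ∀ i, f i ∈ invariants W) (hpos : ∀ i, 0 < deg i)
    (hdeg : ∀ i, (f i).IsHomogeneous (deg i))
    (hspan : Ideal.span (homogeneousInvariants W) = Ideal.span (Set.range f)) :
    Algebra.adjoin ℂ (Set.range f) = invariants W := by
  have := Fintype.ofFinite W
  apply le_antisymm
  · rw [Algebra.adjoin_le_iff]
    rintro _ ⟨i, rfl⟩
    exact hf i
  have key : ∀ m p, p ∈ invariants W → p.IsHomogeneous m →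
      p ∈ Algebra.adjoin ℂ (Set.range f) := by
    intro m
    induction m using Nat.strong_induction_on with
    | _ m ih =>
      intro p hp hm
      rcases Nat.eq_zero_or_pos m with rfl | hm0
      · rw [← totalDegree_zero_iff_isHomogeneous, totalDegree_eq_zero_iff_eq_C] at hm
        rw [hm]
        exact Subalgebra.algebraMap_mem _ _
      have h1 : p ∈ Ideal.span (Set.range f) :=
        hspan ▸ Ideal.subset_span ⟨hp, m, hm0, hm⟩
      obtain ⟨a, ha⟩ := Ideal.mem_span_range_iff_exists_fun.mp h1
      -- Averaging replaces the coefficients by invariants of degree `m - deg i < m`, to which the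
      -- induction applies.
      have h2 := congrArg (avg W) (congrArg (homogeneousComponent m) ha)
      rw [homogeneousComponent_eq_self hm, avg_of_mem hp, map_sum, map_sum] at h2
      rw [← h2]
      refine sum_mem fun i _ => ?_
      rw [homogeneousComponent_mul_of_isHomogeneous (hdeg i)]
      split_ifs with hi
      · rw [avg_mul_of_mem (hf i)]
        refine mul_mem (ih (m - deg i) (by have := hpos i; omega) _ (avg_mem_invariants _)
          (isHomogeneous_avg (homogeneousComponent_isHomogeneous _ _)))
          (Algebra.subset_adjoin ⟨i, rfl⟩)
      · rw [map_zero]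
        exact zero_mem _
  intro p hp
  rw [← sum_homogeneousComponent p]
  exact sum_mem fun m _ => key m _ (homogeneousComponent_mem_invariants hp m)
    (homogeneousComponent_isHomogeneous m p)

/-- Differentiating the relation gives `∑ h_i ∂_k f_i = 0` with invariant `h_i = (∂_i H)(f)`. By
flatness, the vectors `(∂_k f_i)_i` are combinations of invariant syzygies of `h`; the constant
terms of those syzygies decide the matter. -/
theorem invariant_relation_pderiv_eq_zero [Finite W]
    (hgen : Subgroup.closure (reflections W) = W)
    (hf : ∀ i, f i ∈ invariants W) (hpos : ∀ i, 0 < deg i)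
    (hdeg : ∀ i, (f i).IsHomogeneous (deg i))
    (hspan : Ideal.span (homogeneousInvariants W) = Ideal.span (Set.range f))
    (hmin : ∀ i, f i ∉ Ideal.span (f '' {j | j ≠ i})) {H : MvPolynomial ι ℂ}
    (hH : aeval f H = 0) (i : ι) : aeval f (pderiv i H) = 0 := by
  classical
  set h : ι → SymV ℓ := fun i => aeval f (pderiv i H) with hdef
  have hinv : ∀ i, h i ∈ invariants W := by
    intro i
    rw [← adjoin_eq_invariants hf hpos hdeg hspan, Algebra.adjoin_range_eq_range_aeval]
    exact ⟨_, rfl⟩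
  have hsyz : ∀ k, (fun i => pderiv k (f i)) ∈
      Submodule.span (SymV ℓ) (invariantSyzygies W h) := by
    intro k
    refine mem_span_invariantSyzygies hgen hinv ?_
    have h1 := derivation_algebraMap_apply (aeval f) (pderiv k) H
    rw [hH, map_zero] at h1
    rw [h1]
    exact Finset.sum_congr rfl fun i _ => by rw [aeval_X, mul_comm]
  let N : Submodule ℂ (ι → ℂ) :=
    { carrier := {v | ∃ κ ∈ invariantSyzygies W h, v = fun i => constantCoeff (κ i)}
      zero_mem' := ⟨0, ⟨fun i => zero_mem _, by simp⟩, by ext; simp⟩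
      add_mem' := by
        rintro _ _ ⟨κ, hκ, rfl⟩ ⟨κ', hκ', rfl⟩
        obtain ⟨h1, h2⟩ := mem_invariantSyzygies.mp hκ
        obtain ⟨h1', h2'⟩ := mem_invariantSyzygies.mp hκ'
        refine ⟨κ + κ', mem_invariantSyzygies.mpr ⟨fun i => add_mem (h1 i) (h1' i), ?_⟩, ?_⟩
        · simp only [Pi.add_apply, add_mul, Finset.sum_add_distrib, h2, h2', add_zero]
        · ext i
          simp
      smul_mem' := by
        rintro c _ ⟨κ, hκ, rfl⟩
        obtain ⟨h1, h2⟩ := mem_invariantSyzygies.mp hκ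
        refine ⟨c • κ, mem_invariantSyzygies.mpr
          ⟨fun i => Subalgebra.smul_mem _ (h1 i) c, ?_⟩, ?_⟩
        · simp only [Pi.smul_apply, smul_mul_assoc, ← Finset.smul_sum, h2, smul_zero]
        · ext i
          simp [smul_eq_C_mul] }
  -- If every vector is a vector of constant terms, some square matrix of syzygies has identity
  -- constant term, hence nonzero determinant, and kills `h`. Otherwise a nonzero functional `c`
  -- kills all constant terms; then each `∑ c_i ∂_k f_i` lies in the ideal of the `f_i`.
  by_cases hN : N = ⊤
  · have h1 : ∀ j, ∃ κ ∈ invariantSyzygies W h, Pi.single j 1 = fun i => constantCoeff (κ i) :=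
      fun j => (hN ▸ Submodule.mem_top : Pi.single j (1 : ℂ) ∈ N)
    choose κ hκ1 hκ2 using h1
    have hdet : (Matrix.of κ).det ≠ 0 := by
      intro h0
      have h2 := congrArg constantCoeff h0
      rw [RingHom.map_det, map_zero] at h2
      have h3 : constantCoeff.mapMatrix (Matrix.of κ) = 1 := by
        ext j i
        have := congrFun (hκ2 j) i
        rw [RingHom.mapMatrix_apply, Matrix.map_apply, Matrix.of_apply, ← this, Matrix.one_apply,
          Pi.single_apply]
        simp only [eq_comm]
      rw [h3, Matrix.det_one] at h2
      exact one_ne_zero h2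
    have h4 := Matrix.eq_zero_of_mulVec_eq_zero hdet (v := h) (by
      funext j
      exact (mem_invariantSyzygies.mp (hκ1 j)).2)
    exact congrFun h4 i
  · exfalso
    obtain ⟨lam, hlam0, hlam⟩ := N.exists_le_ker_of_lt_top (lt_top_iff_ne_top.mpr hN)
    set c : ι → ℂ := fun i => lam (Pi.single i 1) with hc
    have hlamv : ∀ v, lam v = ∑ i, v i * c i := by
      intro v
      conv_lhs => rw [pi_eq_sum_univ' v]
      simp [hc]
    have hL : ∀ g ∈ Submodule.span (SymV ℓ) (invariantSyzygies W h),
        ∑ i, C (c i) * g i ∈ Ideal.span (Set.range f) := by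
      intro g hg
      induction hg using Submodule.span_induction with
      | mem κ hκ =>
        have h1 := (mem_invariantSyzygies.mp hκ).1
        rw [← hspan]
        refine mem_span_homogeneousInvariants
          (sum_mem fun i _ => mul_mem (Subalgebra.algebraMap_mem _ _) (h1 i)) ?_
        have h2 : lam (fun i => constantCoeff (κ i)) = 0 := hlam ⟨κ, hκ, rfl⟩
        rw [hlamv] at h2
        rw [map_sum, ← h2]
        exact Finset.sum_congr rfl fun i _ => by rw [map_mul, constantCoeff_C, mul_comm]
      | zero => simp
      | add a b _ _ ha hb =>
        simp only [Pi.add_apply, mul_add, Finset.sum_add_distrib]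
        exact add_mem ha hb
      | smul r a _ ha =>
        simp only [Pi.smul_apply, smul_eq_mul, mul_left_comm _ r, ← Finset.mul_sum]
        exact Ideal.mul_mem_left _ _ ha
    choose r hr using fun k => Ideal.mem_span_range_iff_exists_fun.mp (hL _ (hsyz k))
    -- Multiply by `X k`, sum over `k` and use Euler's identity: the coefficient of `f i` has
    -- constant term `c i * deg i`, which minimality forces to be zero.
    have hrel : ∑ i, (C (c i * deg i) - ∑ k, X k * r k i) * f i = 0 := by
      have h1 : ∀ i, C (c i * deg i) * f i = ∑ k, X k * (C (c i) * pderiv k (f i)) := by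
        intro i
        have h2 := (hdeg i).sum_X_mul_pderiv
        rw [C_mul, mul_assoc, map_natCast, ← nsmul_eq_mul, ← h2, Finset.mul_sum]
        exact Finset.sum_congr rfl fun k _ => by ring
      simp only [sub_mul, Finset.sum_sub_distrib, h1]
      rw [Finset.sum_comm, sub_eq_zero]
      simp only [Finset.sum_mul]
      conv_rhs => rw [Finset.sum_comm]
      refine Finset.sum_congr rfl fun k _ => ?_
      rw [← Finset.mul_sum, ← hr k, Finset.mul_sum]
      exact Finset.sum_congr rfl fun i _ => by ring
    apply hlam0
    ext i
    have h3 := constantCoeff_eq_zero_of_sum_mul_eq_zero hdeg hmin hrel i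
    rw [map_sub, constantCoeff_C, map_sum] at h3
    simp only [map_mul, constantCoeff_X, zero_mul, Finset.sum_const_zero, sub_zero] at h3
    have h4 := (mul_eq_zero.mp h3).resolve_right (Nat.cast_ne_zero.mpr (hpos i).ne')
    simpa [hc] using h4

/-- The partial derivatives of a relation are relations of smaller degree, so by induction they
vanish; a constant relation is zero. -/
theorem algebraicIndependent_of_minimal [Finite W]
    (hgen : Subgroup.closure (reflections W) = W)
    (hf : ∀ i, f i ∈ invariants W) (hpos : ∀ i, 0 < deg i)
    (hdeg : ∀ i, (f i).IsHomogeneous (deg i))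
    (hspan : Ideal.span (homogeneousInvariants W) = Ideal.span (Set.range f))
    (hmin : ∀ i, f i ∉ Ideal.span (f '' {j | j ≠ i})) : AlgebraicIndependent ℂ f := by
  rw [algebraicIndependent_iff]
  suffices h : ∀ n, ∀ H : MvPolynomial ι ℂ, H.totalDegree = n → aeval f H = 0 → H = 0 from
    fun H hH => h _ H rfl hH
  intro n
  induction n using Nat.strong_induction_on with
  | _ n ih =>
    intro H hn hH
    have h1 : ∀ i, pderiv i H = 0 := by
      intro i
      by_contra hne
      exact hne (ih _ (hn ▸ totalDegree_pderiv_lt hne) _ rfl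
        (invariant_relation_pderiv_eq_zero hgen hf hpos hdeg hspan hmin hH i))
    have h2 := eq_C_of_forall_pderiv_eq_zero h1
    rw [h2, aeval_C] at hH
    rw [h2, (map_eq_zero_iff _ (algebraMap ℂ (SymV ℓ)).injective).mp hH, C_0]

end

/-- Chevalley's theorem. -/
theorem exists_isElementary [Finite W] (hgen : Subgroup.closure (reflections W) = W) :
    ∃ (d : Fin ℓ → ℕ) (e : Fin ℓ → SymV ℓ), Monotone d ∧ IsElementary W d e := by
  classical
  have hex : ∃ n, ∃ s : Finset (SymV ℓ), s.card = n ∧ ↑s ⊆ homogeneousInvariants W ∧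
      Ideal.span (homogeneousInvariants W) = Ideal.span (s : Set (SymV ℓ)) := by
    obtain ⟨s, hs1, hs2⟩ := (Submodule.fg_span_iff_fg_span_finset_subset _).mp
      ((isNoetherianRing_iff_ideal_fg (SymV ℓ)).mp inferInstance
        (Ideal.span (homogeneousInvariants W)))
    exact ⟨_, s, rfl, hs1, hs2⟩
  obtain ⟨s, hcard, hs1, hs2⟩ := Nat.find_spec hex
  have hmin : ∀ t : Finset (SymV ℓ), ↑t ⊆ homogeneousInvariants W →
      Ideal.span (homogeneousInvariants W) = Ideal.span (t : Set (SymV ℓ)) → s.card ≤ t.card :=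
    fun t h1 h2 => hcard.trans_le (Nat.find_min' hex ⟨t, rfl, h1, h2⟩)
  let f : s → SymV ℓ := Subtype.val
  have hinv : ∀ i, f i ∈ invariants W := fun i => (hs1 i.2).1
  choose deg hpos hdeg using fun i : s => (hs1 i.2).2
  have hrange : Set.range f = s := Subtype.range_coe
  have hspan : Ideal.span (homogeneousInvariants W) = Ideal.span (Set.range f) := by
    rw [hrange, hs2]
  have hmin' : ∀ i, f i ∉ Ideal.span (f '' {j | j ≠ i}) := by
    intro i hi
    have himg : f '' {j | j ≠ i} = (s.erase i : Finset (SymV ℓ)) := by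
      ext p
      simp only [Set.mem_image, Set.mem_ofPred_eq, Finset.mem_coe, Finset.mem_erase]
      constructor
      · rintro ⟨j, hj, rfl⟩
        exact ⟨fun h => hj (Subtype.ext h), j.2⟩
      · rintro ⟨h1, h2⟩
        exact ⟨⟨p, h2⟩, fun h => h1 (congrArg Subtype.val h), rfl⟩
    rw [himg] at hi
    have h1 := hmin (s.erase i) ((Finset.coe_subset.mpr (Finset.erase_subset _ _)).trans hs1) (by
      rw [hs2]
      apply le_antisymm
      · rw [Ideal.span_le]
        intro p hp
        by_cases hpi : p = i
        · rw [hpi]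
          exact hi
        · exact Ideal.subset_span (Finset.mem_coe.mpr (Finset.mem_erase.mpr ⟨hpi, hp⟩))
      · exact Ideal.span_mono (Finset.coe_subset.mpr (Finset.erase_subset _ _)))
    exact absurd h1 (not_le.mpr (Finset.card_erase_lt_of_mem i.2))
  have hind := algebraicIndependent_of_minimal hgen hinv hpos hdeg hspan hmin'
  have hadj := adjoin_eq_invariants hinv hpos hdeg hspan
  have halg : Algebra.IsAlgebraic (Algebra.adjoin ℂ (Set.range f)) (SymV ℓ) := by
    rw [hadj]
    have := isIntegral_invariants (W := W)
    infer_instance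
  -- The polynomial ring is algebraic over the invariants, so the generators number its
  -- transcendence degree `ℓ`.
  have hbasis : IsTranscendenceBasis ℂ f := hind.isTranscendenceBasis_iff_isAlgebraic.mpr halg
  have hc := hbasis.cardinalMk_eq (IsTranscendenceBasis.mvPolynomial (Fin ℓ) ℂ)
  obtain ⟨ε⟩ := Cardinal.eq.mp hc
  let d₀ : Fin ℓ → ℕ := fun i => deg (ε.symm i)
  let σ := Tuple.sort d₀
  refine ⟨d₀ ∘ σ, fun i => f (ε.symm (σ i)), Tuple.monotone_sort d₀, fun i => hdeg _, ?_, ?_⟩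
  · exact hind.comp (fun i => ε.symm (σ i)) (ε.symm.injective.comp σ.injective)
  · rw [← hadj]
    congr 1
    exact (σ.trans ε.symm).surjective.range_comp f

end Dunkl
end

/-! ### Dunkl operators: equivariance and commutativity -/

noncomputable section

namespace Dunkl

variable {ℓ : ℕ} {W : Subgroup (Euc ℓ ≃ₗᵢ[ℝ] Euc ℓ)}

/-- The pairing of a vector of `V*`, given by its coordinates, with a vector of `V_ℝ`. -/
def pair (y : Fin ℓ → ℂ) (v : Euc ℓ) : ℂ := ∑ j, y j * (v j : ℂ)

/-- The complex coordinates of a real vector. -/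
def toC (v : Euc ℓ) : Fin ℓ → ℂ := fun j => (v j : ℂ)

/-- The complex-linear extension of `w` to `ℂ^ℓ`. -/
def push (w : Euc ℓ ≃ₗᵢ[ℝ] Euc ℓ) (y : Fin ℓ → ℂ) : Fin ℓ → ℂ :=
  fun k => ∑ j, ((w (basisVec j) k : ℝ) : ℂ) * y j

theorem sum_basisVec (v : Euc ℓ) : v = ∑ i, v i • basisVec i := by
  ext j
  simp [Pi.single_apply]

theorem pair_push (w : Euc ℓ ≃ₗᵢ[ℝ] Euc ℓ) (y : Fin ℓ → ℂ) (v : Euc ℓ) :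
    pair (push w y) (w v) = pair y v := by
  have h : ∀ k, ((w v k : ℝ) : ℂ) = ∑ i, (v i : ℂ) * ((w (basisVec i) k : ℝ) : ℂ) := by
    intro k
    conv_lhs => rw [sum_basisVec v, map_sum]
    simp
  simp only [pair, push, h, Finset.sum_mul_sum]
  rw [Finset.sum_comm]
  refine Finset.sum_congr rfl fun j _ => ?_
  rw [Finset.sum_comm]
  have h2 : ∀ i, ∑ k, ((w (basisVec j) k : ℝ) : ℂ) * y j * (v i * ((w (basisVec i) k : ℝ) : ℂ)) =
      if j = i then y j * v i else 0 := by
    intro i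
    have h3 : ∀ k, ((w (basisVec j) k : ℝ) : ℂ) * y j * (v i * ((w (basisVec i) k : ℝ) : ℂ)) =
        y j * v i * (((w (basisVec j) k : ℝ) : ℂ) * ((w (basisVec i) k : ℝ) : ℂ)) :=
      fun k => by ring
    simp only [h3, ← Finset.mul_sum, sum_apply_basisVec_mul]
    split_ifs <;> simp
  simp [h2]

theorem pair_smul (y : Fin ℓ → ℂ) (a : ℝ) (v : Euc ℓ) : pair y (a • v) = a * pair y v := by
  simp only [pair, Finset.mul_sum]
  exact Finset.sum_congr rfl fun j _ => by
    rw [WithLp.ofLp_smul, Pi.smul_apply, smul_eq_mul, Complex.ofReal_mul]; ring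

theorem push_reflection (s : reflections W) (y : Fin ℓ → ℂ) :
    push (s : Euc ℓ ≃ₗᵢ[ℝ] Euc ℓ) y =
      y - (2 / (‖root s‖ ^ 2 : ℝ) * pair y (root s) : ℂ) • toC (root s) := by
  funext k
  have h : ∀ j, ((((s : Euc ℓ ≃ₗᵢ[ℝ] Euc ℓ) (basisVec j)) k : ℝ) : ℂ) * y j =
      (if k = j then y j else 0) -
        2 / (‖root s‖ ^ 2 : ℝ) * (y j * (root s j : ℂ)) * (root s k : ℂ) := by
    intro j
    rw [reflection_apply, corootCoeff, inner_basisVec]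
    simp only [WithLp.ofLp_sub, WithLp.ofLp_smul, Pi.sub_apply, Pi.smul_apply, smul_eq_mul,
      Complex.ofReal_sub, Complex.ofReal_mul, Complex.ofReal_div, PiLp.single_apply,
      Complex.ofReal_ofNat]
    split_ifs <;> push_cast <;> ring
  simp only [push, h, Finset.sum_sub_distrib, Pi.sub_apply, Pi.smul_apply, smul_eq_mul, toC, pair,
    Finset.mul_sum, Finset.sum_mul]
  simp

variable (c : reflections W → ℂ)

theorem finite_reflections [Finite W] : Finite (reflections W) :=
  Finite.of_injective (fun s : reflections W => (⟨s, s.2.1⟩ : W)) fun _ _ h =>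
    Subtype.ext (congrArg (fun w : W => (w : Euc ℓ ≃ₗᵢ[ℝ] Euc ℓ)) h)

section

variable [Fintype (reflections W)]

theorem dunkl_apply (y : Fin ℓ → ℂ) (q : SymV ℓ) :
    dunkl c y q = ∑ j, y j • pderiv j q -
      ∑ s : reflections W, (c s * pair y (root s)) • divDiff s q := by
  rw [dunkl, finsum_eq_sum_of_fintype]
  simp [pair]

theorem dunkl_add (y z : Fin ℓ → ℂ) (q : SymV ℓ) :
    dunkl c (y + z) q = dunkl c y q + dunkl c z q := by
  simp only [dunkl_apply, pair, Pi.add_apply, add_mul, Finset.sum_add_distrib, mul_add, add_smul]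
  abel

theorem dunkl_smul (a : ℂ) (y : Fin ℓ → ℂ) (q : SymV ℓ) :
    dunkl c (a • y) q = a • dunkl c y q := by
  have h : pair (a • y) = fun v => a * pair y v := by
    funext v
    simp [pair, Finset.mul_sum, mul_assoc]
  simp only [dunkl_apply, h, Pi.smul_apply, smul_eq_mul, smul_sub, Finset.smul_sum, smul_smul]
  congr 1
  exact Finset.sum_congr rfl fun s _ => by rw [mul_left_comm]

theorem dunkl_lin_mul (y : Fin ℓ → ℂ) (v : Euc ℓ) (q : SymV ℓ) :
    dunkl c y (lin v * q) = lin v * dunkl c y q + pair y v • q -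
      ∑ s : reflections W, (c s * pair y (root s) * (corootCoeff s v : ℂ)) •
        act (s : Euc ℓ ≃ₗᵢ[ℝ] Euc ℓ) q := by
  have h1 : ∀ j, y j • pderiv j (lin v * q) = lin v * (y j • pderiv j q) + (y j * v j) • q := by
    intro j
    have h2 : pderiv j (lin v) = C (v j : ℂ) := by
      simp [lin, pderiv_X, Pi.single_apply]
    rw [Derivation.leibniz, h2, smul_eq_mul, smul_eq_mul]
    simp only [smul_eq_C_mul, C_mul]
    ring
  have h3 : ∀ s : reflections W, (c s * pair y (root s)) • divDiff s (lin v * q) =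
      lin v * ((c s * pair y (root s)) • divDiff s q) +
        (c s * pair y (root s) * (corootCoeff s v : ℂ)) •
          act (s : Euc ℓ ≃ₗᵢ[ℝ] Euc ℓ) q := by
    intro s
    rw [divDiff_mul, divDiff_lin]
    simp only [smul_eq_C_mul, C_mul]
    ring
  rw [dunkl_apply, dunkl_apply]
  simp only [h1, h3, Finset.sum_add_distrib, ← Finset.mul_sum, ← Finset.sum_smul, mul_sub]
  rw [← pair]
  ring

end

/-- Conjugation by `w ∈ W` as a permutation of the reflections. -/
def conjReflections {w : Euc ℓ ≃ₗᵢ[ℝ] Euc ℓ} (hw : w ∈ W) : reflections W ≃ reflections W :=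
  have key : ∀ u ∈ W, ∀ s ∈ reflections W, u * s * u⁻¹ ∈ reflections W := by
    rintro u hu s ⟨hs, α, hα, rfl⟩
    refine ⟨mul_mem (mul_mem hu hs) (inv_mem hu), u α, by simpa using hα, ?_⟩
    ext v : 1
    change u ((ℝ ∙ α)ᗮ.reflection (u.symm v)) = _
    simp only [Submodule.reflection_orthogonal_apply, Submodule.reflection_singleton_apply,
      map_neg, map_sub, map_smul, u.apply_symm_apply, LinearIsometryEquiv.norm_map, map_nsmul]
    rw [← u.inner_map_map α, u.apply_symm_apply]
  { toFun := fun s => ⟨w * s * w⁻¹, key w hw s s.2⟩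
    invFun := fun s => ⟨w⁻¹ * s * w, by simpa using key w⁻¹ (inv_mem hw) s s.2⟩
    left_inv := fun s => Subtype.ext (by simp [mul_assoc])
    right_inv := fun s => Subtype.ext (by simp [mul_assoc]) }

/-- Chosen roots are matched by `w` only up to a factor `κ`, but the product of the pairing and the
divided difference does not depend on the scale of the root. -/
theorem pair_smul_divDiff_conj {w : Euc ℓ ≃ₗᵢ[ℝ] Euc ℓ} (hw : w ∈ W) (s : reflections W)
    (y : Fin ℓ → ℂ) (q : SymV ℓ) :
    pair (push w y) (root (conjReflections hw s)) • divDiff (conjReflections hw s) (act w q) =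
      pair y (root s) • act w (divDiff s q) := by
  set t := conjReflections hw s with ht
  have htw : (t : Euc ℓ ≃ₗᵢ[ℝ] Euc ℓ) = w * s * w⁻¹ := rfl
  have hs0 : (s : Euc ℓ ≃ₗᵢ[ℝ] Euc ℓ) (root s) = -root s := by
    have h := eq_reflection s
    conv_lhs => rw [h]
    exact Submodule.reflection_mem_subspace_orthogonal_precomplement_eq_neg
      (Submodule.mem_span_singleton_self (root s))
  obtain ⟨κ, hκ⟩ : ∃ κ : ℝ, w (root s) = κ • root t := by
    have h1 : (t : Euc ℓ ≃ₗᵢ[ℝ] Euc ℓ) (w (root s)) = -w (root s) := by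
      rw [htw]
      change w (s.1 (w.symm (w (root s)))) = _
      rw [w.symm_apply_apply, hs0, map_neg]
    rw [reflection_apply] at h1
    refine ⟨corootCoeff t (w (root s)) / 2, ?_⟩
    rw [div_eq_inv_mul, mul_smul, eq_inv_smul_iff₀ two_ne_zero, two_smul]
    rw [sub_eq_iff_eq_add] at h1
    conv_rhs => rw [← sub_eq_iff_eq_add'.mpr h1]
    abel
  have hdiv : divDiff t (act w q) = C (κ : ℂ) * act w (divDiff s q) := by
    apply divDiff_eq_of_mul_eq
    have h2 := congrArg (act w) (divDiff_spec s q)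
    rw [map_mul, act_lin, hκ, lin_smul, map_sub, ← AlgHom.comp_apply, ← act_mul] at h2
    rw [← AlgHom.comp_apply (act (t : Euc ℓ ≃ₗᵢ[ℝ] Euc ℓ)), ← act_mul, htw,
      inv_mul_cancel_right, ← h2]
    ring
  rw [hdiv, ← pair_push w y (root s), hκ, pair_smul]
  simp only [smul_eq_C_mul, C_mul]
  ring

variable {c}

theorem act_dunkl [Finite W] (hc : IsConjInvariant c) {w : Euc ℓ ≃ₗᵢ[ℝ] Euc ℓ} (hw : w ∈ W)
    (y : Fin ℓ → ℂ) (q : SymV ℓ) : act w (dunkl c y q) = dunkl c (push w y) (act w q) := by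
  have := finite_reflections (W := W)
  have := Fintype.ofFinite (reflections W)
  rw [dunkl_apply, dunkl_apply, map_sub, map_sum, map_sum]
  congr 1
  · simp only [pderiv_act, push, Finset.sum_smul, Finset.smul_sum]
    conv_rhs => rw [Finset.sum_comm]
    refine Finset.sum_congr rfl fun j _ => ?_
    rw [Finset.sum_comm]
    have h : ∀ i, ∑ k, (((w (basisVec i) k : ℝ) : ℂ) * y i) •
        (C ((w (basisVec j) k : ℝ) : ℂ) * act w (pderiv j q)) =
        if i = j then y j • act w (pderiv j q) else 0 := by
      intro i
      have h3 : ∀ k, (((w (basisVec i) k : ℝ) : ℂ) * y i) •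
        (C ((w (basisVec j) k : ℝ) : ℂ) * act w (pderiv j q)) =
          C (((w (basisVec i) k : ℝ) : ℂ) * ((w (basisVec j) k : ℝ) : ℂ)) *
            (y i • act w (pderiv j q)) := by
        intro k
        simp only [smul_eq_C_mul, C_mul]
        ring
      simp only [h3, ← Finset.sum_mul, ← map_sum, sum_apply_basisVec_mul]
      split_ifs with hij
      · rw [hij, C_1, one_mul]
      · rw [C_0, zero_mul]
    rw [map_smul]
    simp [h]
  · refine Fintype.sum_equiv (conjReflections hw) _ _ fun s => ?_
    rw [map_smul, hc s (conjReflections hw s) w hw rfl, mul_smul, mul_smul,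
      pair_smul_divDiff_conj]

theorem act_sub_dunkl_comm [Finite W] (hc : IsConjInvariant c) (s : reflections W)
    (z : Fin ℓ → ℂ) (q : SymV ℓ) :
    act (s : Euc ℓ ≃ₗᵢ[ℝ] Euc ℓ) (dunkl c z q) - dunkl c z (act (s : Euc ℓ ≃ₗᵢ[ℝ] Euc ℓ) q) =
      -((2 / (‖root s‖ ^ 2 : ℝ) * pair z (root s) : ℂ) •
        dunkl c (toC (root s)) (act (s : Euc ℓ ≃ₗᵢ[ℝ] Euc ℓ) q)) := by
  have := finite_reflections (W := W)
  have := Fintype.ofFinite (reflections W)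
  rw [act_dunkl hc s.2.1, push_reflection, sub_eq_add_neg z, ← neg_smul, dunkl_add, dunkl_smul,
    neg_smul]
  abel

/-- Dunkl operators commute. -/
theorem dunkl_comm [Finite W] (hc : IsConjInvariant c) (y z : Fin ℓ → ℂ) (q : SymV ℓ) :
    dunkl c y (dunkl c z q) = dunkl c z (dunkl c y q) := by
  have := finite_reflections (W := W)
  have := Fintype.ofFinite (reflections W)
  induction q using MvPolynomial.induction_on with
  | C a =>
    have h : ∀ y, dunkl c y (C a) = 0 := by
      intro y
      simp [dunkl_apply, divDiff_C]
    rw [h, h, map_zero, map_zero]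
  | add p q hp hq => rw [map_add, map_add, map_add, map_add, hp, hq]
  | mul_X q i hq =>
    rw [mul_comm, ← lin_basisVec]
    set v := basisVec i
    -- Every term but the first is visibly symmetric under `y ↔ z`: the first two sums are
    -- exchanged, and the last is symmetric because moving `s` past `∇_z` produces the factor `⟨z,
    -- α_s⟩`. The first term is the induction hypothesis.
    have key : ∀ y z, dunkl c y (dunkl c z (lin v * q)) = lin v * dunkl c y (dunkl c z q) +
        (pair y v • dunkl c z q + pair z v • dunkl c y q) -
        ∑ s : reflections W, (c s * pair y (root s) * (corootCoeff s v : ℂ)) •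
          dunkl c z (act (s : Euc ℓ ≃ₗᵢ[ℝ] Euc ℓ) q) -
        ∑ s : reflections W, (c s * pair z (root s) * (corootCoeff s v : ℂ)) •
          dunkl c y (act (s : Euc ℓ ≃ₗᵢ[ℝ] Euc ℓ) q) +
        ∑ s : reflections W, (c s * (pair y (root s) * pair z (root s)) * (corootCoeff s v : ℂ) *
          (2 / (‖root s‖ ^ 2 : ℝ))) •
          dunkl c (toC (root s)) (act (s : Euc ℓ ≃ₗᵢ[ℝ] Euc ℓ) q) := by
      intro y z
      have h1 : ∀ s : reflections W, (c s * pair y (root s) * (corootCoeff s v : ℂ)) •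
          act (s : Euc ℓ ≃ₗᵢ[ℝ] Euc ℓ) (dunkl c z q) =
          (c s * pair y (root s) * (corootCoeff s v : ℂ)) •
            dunkl c z (act (s : Euc ℓ ≃ₗᵢ[ℝ] Euc ℓ) q) -
          (c s * (pair y (root s) * pair z (root s)) * (corootCoeff s v : ℂ) *
            (2 / (‖root s‖ ^ 2 : ℝ))) •
            dunkl c (toC (root s)) (act (s : Euc ℓ ≃ₗᵢ[ℝ] Euc ℓ) q) := by
        intro s
        rw [sub_eq_iff_eq_add.mp (act_sub_dunkl_comm hc s z q)]
        simp only [smul_eq_C_mul, C_mul]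
        ring
      rw [dunkl_lin_mul, map_sub, map_add, dunkl_lin_mul, map_smul, map_sum]
      simp only [map_smul, h1, Finset.sum_sub_distrib]
      abel
    rw [key y z, key z y, hq]
    simp only [mul_comm (pair y (root _)) (pair z (root _))]
    abel

end Dunkl
end

/-! ### The operators `∇_p` and the contravariant pairing -/

noncomputable section

open scoped IsMulCommutative in
/-- Substitution of commuting elements of a noncommutative algebra into polynomials. -/
theorem MvPolynomial.exists_algHom_of_commute {R A : Type*} [CommRing R] [Ring A] [Algebra R A]
    {n : ℕ} (T : Fin n → A) (hT : ∀ i j, T i * T j = T j * T i) :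
    ∃ Φ : MvPolynomial (Fin n) R →ₐ[R] A,
      (∀ p, Φ p = ∑ m ∈ p.support, coeff m p • (List.ofFn fun j => T j ^ m j).prod) ∧
        ∀ j, Φ (X j) = T j := by
  have : IsMulCommutative (Algebra.adjoin R (Set.range T)) := Algebra.isMulCommutative_adjoin R (by
    rintro _ ⟨i, rfl⟩ _ ⟨j, rfl⟩
    exact hT i j)
  let t : Fin n → Algebra.adjoin R (Set.range T) := fun i => ⟨T i, Algebra.subset_adjoin ⟨i, rfl⟩⟩
  refine ⟨(Algebra.adjoin R (Set.range T)).val.comp (aeval t),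
    fun p => ?_, fun j => by rw [AlgHom.comp_apply, aeval_X]; rfl⟩
  rw [AlgHom.comp_apply, aeval_def, eval₂_eq', map_sum]
  refine Finset.sum_congr rfl fun m _ => ?_
  rw [← Algebra.smul_def, map_smul, ← List.prod_ofFn, map_list_prod, List.map_ofFn]
  rfl

namespace Dunkl

variable {ℓ : ℕ} {W : Subgroup (Euc ℓ ≃ₗᵢ[ℝ] Euc ℓ)} [Finite W] {c : reflections W → ℂ}

theorem exists_nabla (hc : IsConjInvariant c) :
    ∃ Φ : SymDual ℓ →ₐ[ℂ] Module.End ℂ (SymV ℓ),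
      (∀ p, Φ p = dunklPoly c p) ∧ ∀ j, Φ (X j) = dunkl c (Pi.single j 1) := by
  have hcomm : ∀ y z : Fin ℓ → ℂ, dunkl c y * dunkl c z = dunkl c z * dunkl c y := by
    intro y z
    refine LinearMap.ext fun q => ?_
    rw [Module.End.mul_apply, Module.End.mul_apply]
    exact dunkl_comm hc y z q
  obtain ⟨Φ, h1, h2⟩ := MvPolynomial.exists_algHom_of_commute (R := ℂ)
    (fun j : Fin ℓ => dunkl c (Pi.single j 1)) fun i j => hcomm _ _
  refine ⟨Φ, fun p => ?_, h2⟩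
  rw [h1, dunklPoly]

/-- The action `p ↦ ∇_p` of `S(V*)` on `S(V)` as an algebra map. -/
def nabla (hc : IsConjInvariant c) : SymDual ℓ →ₐ[ℂ] Module.End ℂ (SymV ℓ) :=
  (exists_nabla hc).choose

theorem nabla_apply (hc : IsConjInvariant c) (p : SymDual ℓ) : nabla hc p = dunklPoly c p :=
  (exists_nabla hc).choose_spec.1 p

theorem nabla_X (hc : IsConjInvariant c) (j : Fin ℓ) :
    nabla hc (X j) = dunkl c (Pi.single j 1) :=
  (exists_nabla hc).choose_spec.2 j

theorem nabla_mul_apply (hc : IsConjInvariant c) (p q : SymDual ℓ) (x : SymV ℓ) :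
    nabla hc (p * q) x = nabla hc p (nabla hc q x) := by
  rw [map_mul, Module.End.mul_apply]

theorem nabla_C_apply (hc : IsConjInvariant c) (a : ℂ) (x : SymV ℓ) :
    nabla hc (C a) x = a • x := by
  rw [← MvPolynomial.algebraMap_eq, AlgHom.commutes, Module.algebraMap_end_apply]

theorem nabla_sum_C_mul_X (hc : IsConjInvariant c) (y : Fin ℓ → ℂ) :
    nabla hc (∑ j, C (y j) * X j) = dunkl c y := by
  have := finite_reflections (W := W)
  have := Fintype.ofFinite (reflections W)
  refine LinearMap.ext fun x => ?_
  rw [map_sum, LinearMap.sum_apply]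
  simp only [nabla_mul_apply, nabla_C_apply, nabla_X]
  let D : (Fin ℓ → ℂ) →ₗ[ℂ] SymV ℓ :=
    { toFun := fun y => dunkl c y x
      map_add' := fun y z => dunkl_add c y z x
      map_smul' := fun a y => dunkl_smul c a y x }
  change ∑ j, y j • D (Pi.single j 1) = D y
  conv_rhs => rw [pi_eq_sum_univ' y, map_sum]
  simp only [map_smul]

theorem act_nabla (hc : IsConjInvariant c) {w : Euc ℓ ≃ₗᵢ[ℝ] Euc ℓ} (hw : w ∈ W) (p : SymDual ℓ)
    (x : SymV ℓ) : act w (nabla hc p x) = nabla hc (act w p) (act w x) := by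
  induction p using MvPolynomial.induction_on generalizing x with
  | C a => rw [act_C, nabla_C_apply, nabla_C_apply, map_smul]
  | add p q hp hq => simp only [map_add, LinearMap.add_apply, hp, hq]
  | mul_X p j hp =>
    rw [nabla_mul_apply, hp, map_mul, nabla_mul_apply, nabla_X, act_dunkl hc hw, act_X, lin,
      nabla_sum_C_mul_X]
    congr 3
    funext k
    simp [push, Pi.single_apply]

theorem isHomogeneous_dunkl (y : Fin ℓ → ℂ) {n : ℕ} {x : SymV ℓ}
    (hx : x.IsHomogeneous (n + 1)) : (dunkl c y x).IsHomogeneous n := by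
  have := finite_reflections (W := W)
  have := Fintype.ofFinite (reflections W)
  rw [dunkl_apply, ← mem_homogeneousSubmodule]
  exact sub_mem (sum_mem fun j _ => Submodule.smul_mem _ _ (hx.pderiv (i := j)))
    (sum_mem fun s _ => Submodule.smul_mem _ _ (isHomogeneous_divDiff s hx))

theorem isHomogeneous_nabla (hc : IsConjInvariant c) {m n : ℕ} {p : SymDual ℓ} {x : SymV ℓ}
    (hp : p.IsHomogeneous m) (hx : x.IsHomogeneous (n + m)) :
    (nabla hc p x).IsHomogeneous n := by
  have key : ∀ (m n : ℕ) (ν : Fin ℓ →₀ ℕ), ν.degree = m → ∀ a (x : SymV ℓ),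
      x.IsHomogeneous (n + m) → (nabla hc (monomial ν a) x).IsHomogeneous n := by
    intro m
    induction m with
    | zero =>
      intro n ν hν a x hx
      rw [(Finsupp.degree_eq_zero_iff ν).mp hν, ← C_apply, nabla_C_apply,
        ← mem_homogeneousSubmodule]
      exact Submodule.smul_mem _ _ hx
    | succ m ih =>
      intro n ν hν a x hx
      obtain ⟨ν, j, rfl, hd⟩ := exists_eq_add_single_of_degree_eq_succ hν
      have hX : monomial (ν + Finsupp.single j 1) a = monomial ν a * X j := by
        rw [X, monomial_mul, mul_one]
      rw [hX, nabla_mul_apply, nabla_X]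
      exact ih n ν hd a _ (isHomogeneous_dunkl _ hx)
  rw [p.as_sum, map_sum, LinearMap.sum_apply]
  refine IsHomogeneous.sum _ _ _ fun ν hν => key m n ν ?_ _ x hx
  have := hp (mem_support_iff.mp hν)
  rwa [Finsupp.degree_eq_weight_one]

theorem dunkl_C (y : Fin ℓ → ℂ) (a : ℂ) : dunkl c y (C a) = 0 := by
  have := finite_reflections (W := W)
  have := Fintype.ofFinite (reflections W)
  simp [dunkl_apply, divDiff_C]

theorem nabla_eq_zero_of_lt (hc : IsConjInvariant c) {m n : ℕ} {p : SymDual ℓ} {x : SymV ℓ}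
    (hp : p.IsHomogeneous m) (hx : x.IsHomogeneous n) (hlt : n < m) : nabla hc p x = 0 := by
  have key : ∀ (m n : ℕ) (ν : Fin ℓ →₀ ℕ), ν.degree = m → n < m → ∀ a (x : SymV ℓ),
      x.IsHomogeneous n → nabla hc (monomial ν a) x = 0 := by
    intro m
    induction m with
    | zero => intro n ν _ hlt; omega
    | succ m ih =>
      intro n ν hν hlt a x hx
      obtain ⟨ν, j, rfl, hd⟩ := exists_eq_add_single_of_degree_eq_succ hν
      have hX : monomial (ν + Finsupp.single j 1) a = monomial ν a * X j := by
        rw [X, monomial_mul, mul_one]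
      rw [hX, nabla_mul_apply, nabla_X]
      rcases n with _ | n
      · rw [← totalDegree_zero_iff_isHomogeneous, totalDegree_eq_zero_iff_eq_C] at hx
        rw [hx, dunkl_C, map_zero]
      · exact ih n ν hd (by omega) a _ (isHomogeneous_dunkl _ hx)
  rw [p.as_sum, map_sum, LinearMap.sum_apply]
  refine Finset.sum_eq_zero fun ν hν => key m n ν ?_ hlt _ x hx
  have := hp (mem_support_iff.mp hν)
  rwa [Finsupp.degree_eq_weight_one]

/-- The contravariant pairing `(p, x) ↦ (∇_p x)(0)`. -/
def contra (hc : IsConjInvariant c) : SymDual ℓ →ₗ[ℂ] SymV ℓ →ₗ[ℂ] ℂ :=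
  (LinearMap.compRight ℂ (lcoeff ℂ 0)).comp (nabla hc).toLinearMap

theorem contra_apply (hc : IsConjInvariant c) (p : SymDual ℓ) (x : SymV ℓ) :
    contra hc p x = coeff 0 (nabla hc p x) := rfl

theorem contra_mul (hc : IsConjInvariant c) (p q : SymDual ℓ) (x : SymV ℓ) :
    contra hc (p * q) x = contra hc p (nabla hc q x) := by
  rw [contra_apply, contra_apply, nabla_mul_apply]

/-- If `x` pairs to zero with all `p y`, then `∇_y x` pairs to zero with all `p`, so `∇_y x = 0` by
induction for every `y`. Regularity excludes this in positive degree. -/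
theorem eq_zero_of_contra_eq_zero (hc : IsConjInvariant c) (hreg : IsRegularParameter c) {n : ℕ}
    {x : SymV ℓ} (hx : x.IsHomogeneous n)
    (h : ∀ p, p.IsHomogeneous n → contra hc p x = 0) : x = 0 := by
  induction n generalizing x with
  | zero =>
    have h1 := h 1 (isHomogeneous_one _ _)
    rw [contra_apply, map_one, Module.End.one_apply] at h1
    rw [← totalDegree_zero_iff_isHomogeneous, totalDegree_eq_zero_iff_eq_C] at hx
    rw [hx, h1, C_0]
  | succ n ih =>
    by_contra hne
    refine hreg ⟨x, by rw [hx.totalDegree hne]; exact Nat.succ_pos n, fun y => ?_⟩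
    refine ih (isHomogeneous_dunkl y hx) fun p hp => ?_
    rw [← nabla_sum_C_mul_X hc, ← contra_mul]
    refine h _ (hp.mul (IsHomogeneous.sum _ _ _ fun j _ => ?_))
    simpa using (isHomogeneous_C (Fin ℓ) (y j)).mul (isHomogeneous_X ℂ j)

instance finite_homogeneousSubmodule (n : ℕ) :
    Module.Finite ℂ (homogeneousSubmodule (Fin ℓ) ℂ n) :=
  Module.Finite.iff_fg.mpr (homogeneousSubmodule_fg _ _ n)

/-- For regular `c`, every linear functional on polynomials of degree `n` is represented by a
polynomial of degree `n`. -/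
theorem exists_contra_eq (hc : IsConjInvariant c) (hreg : IsRegularParameter c) (n : ℕ)
    (φ : SymDual ℓ →ₗ[ℂ] ℂ) :
    ∃ x : SymV ℓ, x.IsHomogeneous n ∧ ∀ p, p.IsHomogeneous n → contra hc p x = φ p := by
  let S := homogeneousSubmodule (Fin ℓ) ℂ n
  let Ψ : S →ₗ[ℂ] Module.Dual ℂ S := ((contra hc).flip.compl₁₂ S.subtype S.subtype)
  have hΨ : ∀ x p, Ψ x p = contra hc p x := fun _ _ => rfl
  have hinj : Function.Injective Ψ := by
    rw [injective_iff_map_eq_zero]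
    intro x hx
    apply Subtype.ext
    refine eq_zero_of_contra_eq_zero hc hreg x.2 fun p hp => ?_
    exact LinearMap.congr_fun hx ⟨p, hp⟩
  have hsurj := (LinearMap.injective_iff_surjective_of_finrank_eq_finrank
    Subspace.dual_finrank_eq.symm).mp hinj
  obtain ⟨x, hx⟩ := hsurj (φ.comp S.subtype)
  exact ⟨x, x.2, fun p hp => LinearMap.congr_fun hx ⟨p, hp⟩⟩

end Dunkl
end

/-! ### Additivity of dimensions and multiplicities -/

noncomputable section

theorem Submodule.finrank_eq_inf_ker_add_map {K V V' : Type*} [Field K] [AddCommGroup V]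
    [Module K V] [AddCommGroup V'] [Module K V'] (f : V →ₗ[K] V') (U : Submodule K V)
    [FiniteDimensional K U] :
    Module.finrank K U =
      Module.finrank K (U ⊓ LinearMap.ker f : Submodule K V) + Module.finrank K (U.map f) := by
  rw [← (f.domRestrict U).finrank_range_add_finrank_ker, LinearMap.range_domRestrict, add_comm]
  congr 1
  rw [LinearMap.ker_domRestrict, ← Submodule.finrank_map_subtype_eq U, Submodule.map_comap_subtype]

theorem PowerSeries.mk_mul_one_sub_X_pow {R : Type*} [CommRing R] {a b : ℕ → R} {d : ℕ}
    (hadd : ∀ n, a (n + d) = b (n + d) + a n) (hlt : ∀ n < d, a n = b n) :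
    PowerSeries.mk a * (1 - PowerSeries.X ^ d) = PowerSeries.mk b := by
  ext n
  rw [mul_sub, mul_one, map_sub, PowerSeries.coeff_mk, PowerSeries.coeff_mk,
    PowerSeries.coeff_mul_X_pow']
  split_ifs with h
  · obtain ⟨k, rfl⟩ := Nat.exists_eq_add_of_le' h
    rw [Nat.add_sub_cancel, PowerSeries.coeff_mk, hadd, add_sub_cancel_right]
  · rw [sub_zero, hlt n (not_le.mp h)]

theorem Representation.IsIrreducible.finiteDimensional {k G M : Type*} [Field k] [Group G]
    [Finite G] [AddCommGroup M] [Module k M] {τ : Representation k G M} (hτ : τ.IsIrreducible) :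
    FiniteDimensional k M := by
  have hne : ∃ m : M, m ≠ 0 := by
    by_contra! h
    refine bot_ne_top (α := Subrepresentation τ) ?_
    apply Subrepresentation.toSubmodule_injective
    ext m
    simp [h m]
  obtain ⟨m, hm⟩ := hne
  let N : Subrepresentation τ :=
    { toSubmodule := Submodule.span k (Set.range fun g => τ g m)
      apply_mem_toSubmodule := by
        intro g v hv
        have : Submodule.span k (Set.range fun g => τ g m) ≤
            (Submodule.span k (Set.range fun g => τ g m)).comap (τ g) := by
          rw [Submodule.span_le]
          rintro _ ⟨u, rfl⟩
          refine Submodule.subset_span ⟨g * u, ?_⟩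
          simp
        exact this hv }
  have hN : m ∈ N.toSubmodule := Submodule.subset_span ⟨1, by simp⟩
  rcases eq_bot_or_eq_top N with h | h
  · rw [h] at hN
    exact absurd hN hm
  · have h1 : Submodule.span k (Set.range fun g => τ g m) = ⊤ :=
      congrArg Subrepresentation.toSubmodule h
    exact ⟨h1 ▸ Submodule.fg_span (Set.finite_range _)⟩

namespace Dunkl

variable {ℓ : ℕ} {W : Subgroup (Euc ℓ ≃ₗᵢ[ℝ] Euc ℓ)}

section Multiplicity

variable {M : Type*} [AddCommGroup M] [Module ℂ M]

theorem act_intertwiningMap (τ : Representation ℂ W M) (f : τ.IntertwiningMap (symRep W)) (w : W)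
    (m : M) : f (τ w m) = act (w : Euc ℓ ≃ₗᵢ[ℝ] Euc ℓ) (f m) :=
  Representation.IntertwiningMap.isIntertwining _ _ f w m

/-- Maschke's argument: lift by a linear section of `T`, then average over `W`. -/
theorem exists_intertwiningMap_lift [Finite W] (τ : Representation ℂ W M)
    {U : Submodule ℂ (SymV ℓ)} (hU : ∀ w ∈ W, ∀ x ∈ U, act w x ∈ U) {T : Module.End ℂ (SymV ℓ)}
    (hT : ∀ w ∈ W, ∀ x, act w (T x) = T (act w x)) (g : τ.IntertwiningMap (symRep W))
    (hg : ∀ m, g m ∈ U.map T) :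
    ∃ f : τ.IntertwiningMap (symRep W), (∀ m, f m ∈ U) ∧ ∀ m, T (f m) = g m := by
  have := Fintype.ofFinite W
  let T' : U →ₗ[ℂ] U.map T := T.submoduleMap U
  obtain ⟨s, hs⟩ := T'.exists_rightInverse_of_surjective
    (LinearMap.range_eq_top.mpr (T.submoduleMap_surjective U))
  let f₀ : M →ₗ[ℂ] SymV ℓ := U.subtype ∘ₗ s ∘ₗ g.toLinearMap.codRestrict (U.map T) hg
  have hf₀ : ∀ m, f₀ m ∈ U := fun m => (s _).2
  have hTf₀ : ∀ m, T (f₀ m) = g m := fun m =>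
    congrArg Subtype.val (LinearMap.congr_fun hs ⟨g m, hg m⟩)
  obtain ⟨f₁, hf₁⟩ : ∃ f₁ : M →ₗ[ℂ] SymV ℓ, ∀ m, f₁ m = (Fintype.card W : ℂ)⁻¹ •
      ∑ w : W, act (w : Euc ℓ ≃ₗᵢ[ℝ] Euc ℓ) (f₀ (τ w⁻¹ m)) := by
    refine ⟨(Fintype.card W : ℂ)⁻¹ • ∑ w : W,
      (act (w : Euc ℓ ≃ₗᵢ[ℝ] Euc ℓ)).toLinearMap ∘ₗ f₀ ∘ₗ τ w⁻¹, fun m => ?_⟩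
    rw [LinearMap.smul_apply, LinearMap.sum_apply]
    rfl
  clear_value f₀
  have hequiv : ∀ u m, f₁ (τ u m) = act (u : Euc ℓ ≃ₗᵢ[ℝ] Euc ℓ) (f₁ m) := by
    intro u m
    rw [hf₁, hf₁, map_smul, map_sum]
    refine congrArg ((Fintype.card W : ℂ)⁻¹ • ·) ?_
    rw [← Equiv.sum_comp (Equiv.mulLeft u)]
    refine Finset.sum_congr rfl fun w _ => ?_
    have h1 : τ (u * w)⁻¹ (τ u m) = τ w⁻¹ m := by
      rw [← Module.End.mul_apply, ← map_mul, mul_inv_rev, inv_mul_cancel_right]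
    rw [Equiv.coe_mulLeft, h1, Subgroup.coe_mul, act_mul, AlgHom.comp_apply]
  refine ⟨⟨f₁, fun u => LinearMap.ext fun m => hequiv u m⟩, fun m => ?_, fun m => ?_⟩
  · change f₁ m ∈ U
    rw [hf₁]
    exact U.smul_mem _ (sum_mem fun w _ => hU w w.2 _ (hf₀ _))
  · change T (f₁ m) = g m
    have h : ∀ w : W, T (act (w : Euc ℓ ≃ₗᵢ[ℝ] Euc ℓ) (f₀ (τ w⁻¹ m))) = g m := by
      intro w
      rw [← hT w w.2, hTf₀, ← act_intertwiningMap, ← Module.End.mul_apply, ← map_mul,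
        mul_inv_cancel, map_one, Module.End.one_apply]
    rw [hf₁, map_smul, map_sum, Finset.sum_congr rfl fun w _ => h w, Finset.sum_const,
      Finset.card_univ, ← Nat.cast_smul_eq_nsmul ℂ, smul_smul, inv_mul_cancel₀ (by simp), one_smul]

theorem finiteDimensional_homInto [FiniteDimensional ℂ M] (τ : Representation ℂ W M)
    (U : Submodule ℂ (SymV ℓ)) [FiniteDimensional ℂ U] : FiniteDimensional ℂ (homInto τ U) := by
  let F : homInto τ U →ₗ[ℂ] M →ₗ[ℂ] U :=
    { toFun := fun f => f.1.toLinearMap.codRestrict U f.2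
      map_add' := fun _ _ => rfl
      map_smul' := fun _ _ => rfl }
  refine Module.Finite.of_injective F fun f g h => Subtype.ext ?_
  apply Representation.IntertwiningMap.ext
  ext1 m
  exact congrArg Subtype.val (LinearMap.congr_fun h m)

theorem finrank_homInto_eq_inf_ker_add_map [Finite W] [FiniteDimensional ℂ M]
    (τ : Representation ℂ W M) {U : Submodule ℂ (SymV ℓ)} [FiniteDimensional ℂ U]
    (hU : ∀ w ∈ W, ∀ x ∈ U, act w x ∈ U) {T : Module.End ℂ (SymV ℓ)}
    (hT : ∀ w ∈ W, ∀ x, act w (T x) = T (act w x)) :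
    Module.finrank ℂ (homInto τ U) =
      Module.finrank ℂ (homInto τ (U ⊓ LinearMap.ker T)) +
        Module.finrank ℂ (homInto τ (U.map T)) := by
  let T₁ : (symRep W).IntertwiningMap (symRep W) :=
    ⟨T, fun w => LinearMap.ext fun x => (hT w w.2 x).symm⟩
  let P : τ.IntertwiningMap (symRep W) →ₗ[ℂ] τ.IntertwiningMap (symRep W) :=
    { toFun := fun f => T₁.comp f
      map_add' := fun f g => by
        apply Representation.IntertwiningMap.ext
        ext1 m
        exact map_add T (f m) (g m)
      map_smul' := fun a f => by
        apply Representation.IntertwiningMap.ext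
        ext1 m
        exact map_smul T a (f m) }
  have hP : ∀ f m, P f m = T (f m) := fun _ _ => rfl
  have := finiteDimensional_homInto τ U
  have h1 : homInto τ (U ⊓ LinearMap.ker T) = homInto τ U ⊓ LinearMap.ker P := by
    ext f
    constructor
    · intro hf
      refine ⟨fun m => (hf m).1, ?_⟩
      apply Representation.IntertwiningMap.ext
      ext1 m
      exact (hf m).2
    · rintro ⟨hf, hf'⟩ m
      refine ⟨hf m, ?_⟩
      have := congrArg (fun g : τ.IntertwiningMap (symRep W) => g m) (LinearMap.mem_ker.mp hf')
      exact this
  have h2 : homInto τ (U.map T) = (homInto τ U).map P := by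
    ext g
    constructor
    · intro hg
      obtain ⟨f, hf, hfg⟩ := exists_intertwiningMap_lift τ hU hT g hg
      refine ⟨f, hf, ?_⟩
      apply Representation.IntertwiningMap.ext
      ext1 m
      exact hfg m
    · rintro ⟨f, hf, rfl⟩ m
      exact ⟨f m, hf m, rfl⟩
  rw [h1, h2]
  exact Submodule.finrank_eq_inf_ker_add_map P _

end Multiplicity

end Dunkl
end

/-! ### Common kernels and their series -/

noncomputable section

namespace Dunkl

variable {ℓ : ℕ} {W : Subgroup (Euc ℓ ≃ₗᵢ[ℝ] Euc ℓ)} [Finite W] {c : reflections W → ℂ}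

/-- The common kernel of the operators `∇_{e_i}` for `i ∈ J`. -/
def commonKer (hc : IsConjInvariant c) (e : Fin ℓ → SymDual ℓ) (J : Finset (Fin ℓ)) :
    Submodule ℂ (SymV ℓ) where
  carrier := {x | ∀ i ∈ J, nabla hc (e i) x = 0}
  zero_mem' _ _ := map_zero _
  add_mem' hx hy i hi := by rw [map_add, hx i hi, hy i hi, add_zero]
  smul_mem' a x hx i hi := by rw [map_smul, hx i hi, smul_zero]

theorem mem_commonKer (hc : IsConjInvariant c) {e : Fin ℓ → SymDual ℓ} {J : Finset (Fin ℓ)}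
    {x : SymV ℓ} : x ∈ commonKer hc e J ↔ ∀ i ∈ J, nabla hc (e i) x = 0 := Iff.rfl

theorem nabla_eq_zero_of_mem_span (hc : IsConjInvariant c) {e : Fin ℓ → SymDual ℓ}
    {J : Finset (Fin ℓ)} {p : SymDual ℓ} (hp : p ∈ Ideal.span (e '' J)) {x : SymV ℓ}
    (hx : x ∈ commonKer hc e J) : nabla hc p x = 0 := by
  obtain ⟨a, rfl⟩ := (Submodule.mem_span_image_finset_iff_exists_fun _).mp hp
  rw [map_sum, LinearMap.sum_apply]
  refine Finset.sum_eq_zero fun i _ => ?_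
  rw [smul_eq_mul, nabla_mul_apply, hx i i.2, map_zero]

theorem mem_component {U : Submodule ℂ (SymV ℓ)} {n : ℕ} {x : SymV ℓ} :
    x ∈ component U n ↔ x ∈ U ∧ x.IsHomogeneous n := Iff.rfl

instance finite_component (U : Submodule ℂ (SymV ℓ)) (n : ℕ) :
    FiniteDimensional ℂ (component U n) :=
  Submodule.finiteDimensional_of_le (inf_le_right : _ ≤ homogeneousSubmodule (Fin ℓ) ℂ n)

/-- An invariant `x` pairs with `p` as it does with the average of `p`, which is an invariant
without constant term and so annihilates harmonics. -/
theorem eq_zero_of_mem_harmonics_of_act_eq (hc : IsConjInvariant c) (hreg : IsRegularParameter c) {n : ℕ} (hn : 0 < n)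
    {x : SymV ℓ} (hx : x ∈ component (harmonics c) n) (hfix : ∀ w ∈ W, act w x = x) : x = 0 := by
  have := Fintype.ofFinite W
  refine eq_zero_of_contra_eq_zero hc hreg hx.2 fun p hp => ?_
  have h1 : ∀ w : W, nabla hc (act (w : Euc ℓ ≃ₗᵢ[ℝ] Euc ℓ) p) x = nabla hc p x := by
    intro w
    have h2 : (nabla hc p x).IsHomogeneous 0 :=
      isHomogeneous_nabla hc hp ((zero_add n).symm ▸ hx.2)
    rw [← totalDegree_zero_iff_isHomogeneous, totalDegree_eq_zero_iff_eq_C] at h2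
    conv_lhs => rw [← hfix w w.2]
    rw [← Dunkl.act_nabla hc w.2, h2, act_C]
  have h3 : nabla hc (avg W p) x = nabla hc p x := by
    rw [avg_apply, map_smul, map_sum, LinearMap.smul_apply, LinearMap.sum_apply,
      Finset.sum_congr rfl fun w _ => h1 w, Finset.sum_const, Finset.card_univ,
      ← Nat.cast_smul_eq_nsmul ℂ, smul_smul, inv_mul_cancel₀ (by simp), one_smul]
  have h4 : constantCoeff (avg W p) = 0 := by
    rw [constantCoeff_eq]
    exact (isHomogeneous_avg hp).coeff_eq_zero (by simpa using hn.ne)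
  rw [contra_apply, ← h3, nabla_apply, hx.1 _ (avg_mem_invariants p) h4, coeff_zero]

theorem component_inf_ker (hc : IsConjInvariant c) (e : Fin ℓ → SymDual ℓ) (J : Finset (Fin ℓ)) (j : Fin ℓ) (n : ℕ) :
    component (commonKer hc e J) n ⊓ LinearMap.ker (nabla hc (e j)) =
      component (commonKer hc e (insert j J)) n := by
  ext x
  simp only [Submodule.mem_inf, mem_component, mem_commonKer, Finset.forall_mem_insert,
    LinearMap.mem_ker]
  tauto

namespace IsElementary

variable {d : Fin ℓ → ℕ} {e : Fin ℓ → SymDual ℓ} (he : IsElementary W d e)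
  (hc : IsConjInvariant c)
include he

theorem act_nabla {w : Euc ℓ ≃ₗᵢ[ℝ] Euc ℓ} (hw : w ∈ W) (i : Fin ℓ) (x : SymV ℓ) :
    act w (nabla hc (e i) x) = nabla hc (e i) (act w x) := by
  rw [Dunkl.act_nabla hc hw, act_eq_of_mem (he.mem i) hw]

theorem act_mem_component {J : Finset (Fin ℓ)} {n : ℕ} {w : Euc ℓ ≃ₗᵢ[ℝ] Euc ℓ} (hw : w ∈ W)
    {x : SymV ℓ} (hx : x ∈ component (commonKer hc e J) n) :
    act w x ∈ component (commonKer hc e J) n :=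
  ⟨fun i hi => by rw [← he.act_nabla hc hw, hx.1 i hi, map_zero], isHomogeneous_act w hx.2⟩

theorem truncHarmonics_eq_commonKer (k : ℕ) :
    truncHarmonics c k = commonKer hc e {i | d i < k} := by
  ext x
  constructor
  · intro hx i hi
    rw [nabla_apply]
    exact hx _ (he.mem i) (he.constantCoeff_eq_zero i)
      ((he.homogeneous i).totalDegree_le.trans_lt (by simpa using hi))
  · intro hx p hp h0 hk
    rw [← nabla_apply hc]
    refine nabla_eq_zero_of_mem_span hc ?_ hx
    simpa using he.mem_span_image_of_totalDegree_lt hp h0 hk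

theorem harmonics_eq_commonKer : harmonics c = commonKer hc e Finset.univ := by
  ext x
  constructor
  · intro hx i _
    rw [nabla_apply]
    exact hx _ (he.mem i) (he.constantCoeff_eq_zero i)
  · intro hx p hp h0
    rw [← nabla_apply hc]
    refine nabla_eq_zero_of_mem_span hc (Ideal.span_mono (Set.image_mono ?_)
      (he.mem_span_image_of_totalDegree_lt hp h0 p.totalDegree.lt_succ_self)) hx
    simp

/-- The dual of regularity: multiplication by `e j` is injective modulo the ideal of the `e i`, `i ∈
J`, so its transpose `∇_{e j}` is surjective on the common kernel. -/
theorem exists_nabla_eq (hgen : Subgroup.closure (reflections W) = W)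
    (hreg : IsRegularParameter c) {J : Finset (Fin ℓ)} {j : Fin ℓ} (hj : j ∉ J) {n : ℕ}
    {y : SymV ℓ} (hy : y ∈ component (commonKer hc e J) n) :
    ∃ x ∈ component (commonKer hc e J) (n + d j), nabla hc (e j) x = y := by
  let I : Submodule ℂ (SymDual ℓ) := (Ideal.span (e '' J)).restrictScalars ℂ
  let f : SymDual ℓ →ₗ[ℂ] SymDual ℓ ⧸ I := I.mkQ ∘ₗ LinearMap.mulRight ℂ (e j)
  have hf : ∀ p, f p = I.mkQ (p * e j) := fun _ => rfl
  -- If `p e_j` lies in the ideal, so does `p`, and then `∇_p y = 0`. Hence the functional of `y`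
  -- factors through `p ↦ p e_j` modulo the ideal; a representative `x` of the factor functional is
  -- the required preimage.
  have hψ : (contra hc).flip y ∈ LinearMap.range f.dualMap := by
    rw [LinearMap.range_dualMap_eq_dualAnnihilator_ker, Submodule.mem_dualAnnihilator]
    intro p hp
    rw [LinearMap.mem_ker, hf, Submodule.mkQ_apply, Submodule.Quotient.mk_eq_zero] at hp
    rw [LinearMap.flip_apply, contra_apply,
      nabla_eq_zero_of_mem_span hc (he.mem_span_image_of_mul_mem hgen hj hp) hy.1, coeff_zero]
  obtain ⟨φ, hφ⟩ := hψ
  obtain ⟨x, hx, hxφ⟩ := exists_contra_eq hc hreg (n + d j) (φ ∘ₗ I.mkQ)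
  refine ⟨x, ⟨fun i hi => ?_, hx⟩, ?_⟩
  · rcases lt_or_ge (n + d j) (d i) with hlt | hle
    · exact nabla_eq_zero_of_lt hc (he.homogeneous i) hx hlt
    obtain ⟨k, hk⟩ := Nat.exists_eq_add_of_le' hle
    have hx' : (nabla hc (e i) x).IsHomogeneous k :=
      isHomogeneous_nabla hc (he.homogeneous i) (hk ▸ hx)
    refine eq_zero_of_contra_eq_zero hc hreg hx' fun p hp => ?_
    rw [← contra_mul, hxφ _ (hk ▸ hp.mul (he.homogeneous i)), LinearMap.comp_apply,
      Submodule.mkQ_apply, (Submodule.Quotient.mk_eq_zero I).mpr, map_zero]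
    exact Ideal.mul_mem_left _ _ (Ideal.subset_span ⟨i, hi, rfl⟩)
  · rw [← sub_eq_zero]
    refine eq_zero_of_contra_eq_zero hc hreg
      ((isHomogeneous_nabla hc (he.homogeneous j) hx).sub hy.2) fun p hp => ?_
    rw [map_sub, ← contra_mul, hxφ _ (hp.mul (he.homogeneous j)), sub_eq_zero]
    exact LinearMap.congr_fun hφ p

theorem map_component (hgen : Subgroup.closure (reflections W) = W)
    (hreg : IsRegularParameter c) {J : Finset (Fin ℓ)} {j : Fin ℓ} (hj : j ∉ J) (n : ℕ) :
    (component (commonKer hc e J) (n + d j)).map (nabla hc (e j)) =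
      component (commonKer hc e J) n := by
  ext y
  constructor
  · rintro ⟨x, hx, rfl⟩
    refine ⟨fun i hi => ?_, isHomogeneous_nabla hc (he.homogeneous j) hx.2⟩
    rw [← nabla_mul_apply, mul_comm, nabla_mul_apply, hx.1 i hi, map_zero]
  · intro hy
    obtain ⟨x, hx, hxy⟩ := he.exists_nabla_eq hc hgen hreg hj hy
    exact ⟨x, hx, hxy⟩

theorem component_insert_of_lt (J : Finset (Fin ℓ)) (j : Fin ℓ) {n : ℕ} (hn : n < d j) :
    component (commonKer hc e J) n = component (commonKer hc e (insert j J)) n := by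
  rw [← component_inf_ker hc, eq_comm, inf_eq_left]
  exact fun x hx => nabla_eq_zero_of_lt hc (he.homogeneous j) hx.2 hn

/-- The series `∑ F(U_n) t^n` attached to an invariant `F` of finite-dimensional `W`-submodules
that is additive along equivariant maps changes by the factor `∏ (1 - t^(d_j))` when the conditions
`∇_{e_j} x = 0` are imposed. -/
theorem mk_component_mul_prod (hgen : Subgroup.closure (reflections W) = W)
    (hreg : IsRegularParameter c) (F : Submodule ℂ (SymV ℓ) → ℕ)
    (hF : ∀ (U : Submodule ℂ (SymV ℓ)) (T : Module.End ℂ (SymV ℓ)), FiniteDimensional ℂ U →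
      (∀ w ∈ W, ∀ x ∈ U, act w x ∈ U) → (∀ w ∈ W, ∀ x, act w (T x) = T (act w x)) →
      F U = F (U ⊓ LinearMap.ker T) + F (U.map T))
    (J K : Finset (Fin ℓ)) (hJK : Disjoint J K) :
    PowerSeries.mk (fun n => (F (component (commonKer hc e J) n) : ℤ)) *
        ∏ j ∈ K, (1 - PowerSeries.X ^ d j) =
      PowerSeries.mk fun n => (F (component (commonKer hc e (J ∪ K)) n) : ℤ) := by
  induction K using Finset.induction_on with
  | empty => rw [Finset.prod_empty, mul_one, Finset.union_empty]
  | insert j K hj ih =>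
    rw [Finset.disjoint_insert_right] at hJK
    have hj' : j ∉ J ∪ K := by
      rw [Finset.mem_union]
      exact not_or.mpr ⟨hJK.1, hj⟩
    rw [Finset.prod_insert hj, mul_comm (1 - _), ← mul_assoc, ih hJK.2, Finset.union_insert]
    -- In degrees `n + d j` the map `∇_{e j}` is onto degree `n`; below `d j` it is zero, so the
    -- condition it imposes is void.
    refine PowerSeries.mk_mul_one_sub_X_pow (fun n => ?_) fun n hn => ?_
    · rw [hF (component (commonKer hc e (J ∪ K)) (n + d j)) (nabla hc (e j)) inferInstance
        (fun w hw x hx => he.act_mem_component hc hw hx) (fun w hw x => he.act_nabla hc hw j x),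
        component_inf_ker, he.map_component hc hgen hreg hj', Nat.cast_add]
    · rw [← he.component_insert_of_lt hc _ _ hn]

theorem hilb_mul_prod (hgen : Subgroup.closure (reflections W) = W)
    (hreg : IsRegularParameter c) {J K : Finset (Fin ℓ)} (hJK : Disjoint J K) :
    hilb (commonKer hc e J) * ∏ j ∈ K, (1 - PowerSeries.X ^ d j) =
      hilb (commonKer hc e (J ∪ K)) :=
  he.mk_component_mul_prod hc hgen hreg (fun U => Module.finrank ℂ U)
    (fun U T _ _ _ => Submodule.finrank_eq_inf_ker_add_map T U) J K hJK

theorem gradedChar_mul_prod (hgen : Subgroup.closure (reflections W) = W)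
    (hreg : IsRegularParameter c) {M : Type*} [AddCommGroup M] [Module ℂ M]
    [FiniteDimensional ℂ M] (τ : Representation ℂ W M) {J K : Finset (Fin ℓ)}
    (hJK : Disjoint J K) :
    gradedChar τ (commonKer hc e J) * ∏ j ∈ K, (1 - PowerSeries.X ^ d j) =
      gradedChar τ (commonKer hc e (J ∪ K)) :=
  he.mk_component_mul_prod hc hgen hreg (fun U => Module.finrank ℂ (homInto τ U))
    (fun _ _ _ hU hT => finrank_homInto_eq_inf_ker_add_map τ hU hT) J K hJK

theorem gradedChar_trivial_harmonics (hc : IsConjInvariant c) (hreg : IsRegularParameter c) :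
    gradedChar (Representation.trivial ℂ W ℂ) (harmonics c) = 1 := by
  ext n
  rw [gradedChar, PowerSeries.coeff_mk, PowerSeries.coeff_one]
  have hfix : ∀ (f : (Representation.trivial ℂ W ℂ).IntertwiningMap (symRep W)) (a : ℂ),
      ∀ w ∈ W, act w (f a) = f a := by
    intro f a w hw
    rw [← act_intertwiningMap _ f ⟨w, hw⟩, Representation.trivial_apply]
  split_ifs with hn
  · subst hn
    have hC : ∀ a : ℂ, C a ∈ component (harmonics c) 0 := by
      intro a
      refine ⟨?_, isHomogeneous_C _ _⟩
      rw [he.harmonics_eq_commonKer hc]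
      exact fun i _ => nabla_eq_zero_of_lt hc (he.homogeneous i) (isHomogeneous_C _ _)
        (he.deg_pos i)
    let f₀ : (Representation.trivial ℂ W ℂ).IntertwiningMap (symRep W) :=
      ⟨(Algebra.ofId ℂ (SymV ℓ)).toLinearMap, fun w => LinearMap.ext fun a => (act_C _ a).symm⟩
    have hf₀ : ∀ a, f₀ a = C a := fun _ => rfl
    let v : homInto (Representation.trivial ℂ W ℂ) (component (harmonics c) 0) := ⟨f₀, hC⟩
    rw [finrank_eq_one v, Nat.cast_one]
    · intro h
      have h1 := congrArg (fun g : homInto (Representation.trivial ℂ W ℂ)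
        (component (harmonics c) 0) => g.1 1) h
      exact C_ne_zero.mpr one_ne_zero h1
    · intro g
      have h1 := (g.2 1).2
      rw [SetLike.mem_coe, mem_homogeneousSubmodule, ← totalDegree_zero_iff_isHomogeneous,
        totalDegree_eq_zero_iff_eq_C] at h1
      refine ⟨coeff 0 (g.1 1), Subtype.ext ?_⟩
      apply Representation.IntertwiningMap.ext
      ext1
      change coeff 0 (g.1 1) • C (1 : ℂ) = g.1 1
      rw [smul_eq_C_mul, ← C_mul, mul_one]
      exact h1.symm
  · have : Subsingleton
        (homInto (Representation.trivial ℂ W ℂ) (component (harmonics c) n)) := by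
      refine subsingleton_of_forall_eq 0 fun g => Subtype.ext ?_
      apply Representation.IntertwiningMap.ext
      ext1
      exact eq_zero_of_mem_harmonics_of_act_eq hc hreg (Nat.pos_of_ne_zero hn) (g.2 1)
        (hfix g.1 1)
    rw [Module.finrank_zero_of_subsingleton, Nat.cast_zero]

end IsElementary

theorem finrank_homogeneousSubmodule (n m : ℕ) :
    Module.finrank ℂ (homogeneousSubmodule (Fin (n + 1)) ℂ m) = (n + m).choose n := by
  rw [homogeneousSubmodule_eq_finsupp_supported]
  have h : {d : Fin (n + 1) →₀ ℕ | d.degree = m} =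
      (Finset.finsuppAntidiag Finset.univ m : Finset (Fin (n + 1) →₀ ℕ)) := by
    ext d
    simp [Finset.mem_finsuppAntidiag, Finsupp.degree_eq_sum]
  rw [h]
  refine (Module.finrank_eq_nat_card_basis (basisRestrictSupport ℂ _)).trans ?_
  rw [Nat.card_coe_set_eq, Set.ncard_coe_finset, Finset.card_finsuppAntidiag_nat_eq_choose,
    Finset.card_univ, Fintype.card_fin]
  have : n + 1 + m - 1 = n + m := by omega
  rw [this, Nat.choose_symm_add]

theorem hilb_top (n : ℕ) :
    hilb (⊤ : Submodule ℂ (SymV (n + 1))) * (1 - PowerSeries.X) ^ (n + 1) = 1 := by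
  refine Eq.trans (congrArg (· * _) ?_) (PowerSeries.mk_add_choose_mul_one_sub_pow_eq_one ℤ n)
  ext m
  rw [hilb, PowerSeries.coeff_mk, PowerSeries.coeff_mk, component, top_inf_eq,
    finrank_homogeneousSubmodule]

end Dunkl
end

noncomputable section

namespace Dunkl

namespace IsElementary

variable {ℓ : ℕ} {W : Subgroup (Euc ℓ ≃ₗᵢ[ℝ] Euc ℓ)} [Finite W] {c : reflections W → ℂ}
  {d : Fin ℓ → ℕ} {e : Fin ℓ → SymDual ℓ} (he : IsElementary W d e)
  (hc : IsConjInvariant c)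
include he hc

theorem hilb_truncHarmonics_mul_prod (hgen : Subgroup.closure (reflections W) = W)
    (hreg : IsRegularParameter c) (k : ℕ) :
    hilb (truncHarmonics c k) * ∏ j : Fin ℓ with k ≤ d j, (1 - PowerSeries.X ^ d j) =
      hilb (harmonics c) := by
  rw [he.truncHarmonics_eq_commonKer hc, he.harmonics_eq_commonKer hc]
  simp_rw [← not_lt (b := k)]
  rw [he.hilb_mul_prod hc hgen hreg (Finset.disjoint_filter_filter_not _ _ _),
    Finset.filter_union_filter_not_eq]

theorem gradedChar_truncHarmonics_mul_prod (hgen : Subgroup.closure (reflections W) = W)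
    (hreg : IsRegularParameter c) {M : Type*} [AddCommGroup M] [Module ℂ M]
    [FiniteDimensional ℂ M] (τ : Representation ℂ W M) (k : ℕ) :
    gradedChar τ (truncHarmonics c k) * ∏ j : Fin ℓ with k ≤ d j, (1 - PowerSeries.X ^ d j) =
      gradedChar τ (harmonics c) := by
  rw [he.truncHarmonics_eq_commonKer hc, he.harmonics_eq_commonKer hc]
  simp_rw [← not_lt (b := k)]
  rw [he.gradedChar_mul_prod hc hgen hreg τ (Finset.disjoint_filter_filter_not _ _ _),
    Finset.filter_union_filter_not_eq]

end IsElementary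

/-- All of `S(V)` is the common kernel for the empty set, so the conditions with `d j < k` are
imposed starting from `1 / (1 - t)^(n + 1)`. -/
theorem IsElementary.hilb_truncHarmonics_mul_pow {n : ℕ}
    {W : Subgroup (Euc (n + 1) ≃ₗᵢ[ℝ] Euc (n + 1))} [Finite W] {c : reflections W → ℂ}
    {d : Fin (n + 1) → ℕ} {e : Fin (n + 1) → SymDual (n + 1)} (he : IsElementary W d e)
    (hc : IsConjInvariant c) (hgen : Subgroup.closure (reflections W) = W)
    (hreg : IsRegularParameter c) (k : ℕ) :
    hilb (truncHarmonics c k) * (1 - PowerSeries.X) ^ (n + 1) =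
      ∏ j : Fin (n + 1) with d j < k, (1 - PowerSeries.X ^ d j) := by
  have h0 : commonKer hc e ∅ = ⊤ := by
    rw [eq_top_iff]
    intro x _ i hi
    exact absurd hi (Finset.notMem_empty i)
  have h := he.hilb_mul_prod hc hgen hreg (Finset.disjoint_empty_left {j | d j < k})
  rw [Finset.empty_union, h0] at h
  rw [he.truncHarmonics_eq_commonKer hc, ← h, mul_right_comm, hilb_top, one_mul]

end Dunkl
end

open Dunkl in
-- The rank is `n + 1`, which encodes `ℓ ≥ 1`. Denominators are cleared; this loses nothing, as `1 -
-- t` and the `1 - t^{d_j}` have constant term 1 and are units among power series.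
theorem mainTheorem3 {n : ℕ}
    (W : Subgroup (Euc (n + 1) ≃ₗᵢ[ℝ] Euc (n + 1))) (hW : IsIrreducibleReflectionGroup W) :
    -- the degrees of `W` exist
    (∃ d : Fin (n + 1) → ℕ, IsDegrees W d) ∧
    ∀ d : Fin (n + 1) → ℕ, IsDegrees W d →
    ∀ c : reflections W → ℂ, IsConjInvariant c → IsRegularParameter c →
      -- Hilbert series of the quasiharmonics, with `h = d (Fin.last n)`
      hilb (truncHarmonics c (d (Fin.last n))) * (1 - PowerSeries.X ^ d (Fin.last n)) =
        hilb (harmonics c) ∧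
      hilb (truncHarmonics c (d (Fin.last n))) * (1 - PowerSeries.X) ^ (n + 1) =
        ∏ i : Fin n, (1 - PowerSeries.X ^ d i.castSucc) ∧
      -- graded multiplicities in the quasiharmonics
      (∀ (M : Type*) [AddCommGroup M] [Module ℂ M] (τ : Representation ℂ W M),
        τ.IsIrreducible →
          gradedChar τ (truncHarmonics c (d (Fin.last n))) *
              (1 - PowerSeries.X ^ d (Fin.last n)) =
            gradedChar τ (harmonics c)) ∧
      gradedChar (Representation.trivial ℂ W ℂ) (truncHarmonics c (d (Fin.last n))) *
          (1 - PowerSeries.X ^ d (Fin.last n)) = 1 ∧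
      -- graded multiplicities in the truncated spaces
      ∀ i : Fin (n + 1),
        (∀ (M : Type*) [AddCommGroup M] [Module ℂ M] (τ : Representation ℂ W M),
          τ.IsIrreducible →
            gradedChar τ (truncHarmonics c (d i)) *
                ∏ j : Fin (n + 1) with d i ≤ d j, (1 - PowerSeries.X ^ d j) =
              gradedChar τ (harmonics c)) ∧
        gradedChar (Representation.trivial ℂ W ℂ) (truncHarmonics c (d i)) *
            ∏ j : Fin (n + 1) with d i ≤ d j, (1 - PowerSeries.X ^ d j) = 1 := by
  have := hW.finite
  have hgen := hW.closure_reflections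
  refine ⟨?_, ?_⟩
  · obtain ⟨d, e, hd, he⟩ := exists_isElementary hgen
    exact ⟨d, hd, e, he.homogeneous, he.algebraicIndependent, he.adjoin_eq⟩
  rintro d ⟨hd, e, he₁, he₂, he₃⟩ c hc hreg
  have he : IsElementary W d e := ⟨he₁, he₂, he₃⟩
  -- Simplicity of the largest degree reduces the product over `d j ≥ h` to one factor.
  have hlast : ({j | d (Fin.last n) ≤ d j} : Finset (Fin (n + 1))) = {Fin.last n} := by
    ext j
    simp only [Finset.mem_filter, Finset.mem_univ, true_and, Finset.mem_singleton]
    refine ⟨fun h => ?_, fun h => h ▸ le_rfl⟩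
    exact he.eq_of_deg_eq_max hW (fun i => hd (Fin.le_last i))
      ((hd (Fin.le_last j)).antisymm h) rfl
  have hprod : ∏ j : Fin (n + 1) with d (Fin.last n) ≤ d j,
      (1 - PowerSeries.X ^ d j : PowerSeries ℤ) = 1 - PowerSeries.X ^ d (Fin.last n) := by
    rw [hlast, Finset.prod_singleton]
  have hlt : ∀ i, d i < d (Fin.last n) ↔ i ≠ Fin.last n := by
    intro i
    rw [← not_le, not_iff_not, ← Finset.mem_singleton, ← hlast]
    simp
  refine ⟨?_, ?_, fun M _ _ τ hτ => ?_, ?_, fun i => ⟨fun M _ _ τ hτ => ?_, ?_⟩⟩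
  · rw [← hprod]
    exact he.hilb_truncHarmonics_mul_prod hc hgen hreg _
  · rw [he.hilb_truncHarmonics_mul_pow hc hgen hreg]
    simp only [hlt]
    rw [Finset.prod_filter, Fin.prod_univ_castSucc]
    simp [Fin.castSucc_ne_last]
  · have := hτ.finiteDimensional
    rw [← hprod]
    exact he.gradedChar_truncHarmonics_mul_prod hc hgen hreg τ _
  · rw [← hprod]
    exact (he.gradedChar_truncHarmonics_mul_prod hc hgen hreg _ _).trans
      (he.gradedChar_trivial_harmonics hc hreg)
  · have := hτ.finiteDimensional
    exact he.gradedChar_truncHarmonics_mul_prod hc hgen hreg τ _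
  · exact (he.gradedChar_truncHarmonics_mul_prod hc hgen hreg _ _).trans
      (he.gradedChar_trivial_harmonics hc hreg)
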